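/- Let $C\subset[0,1]$ be the middle-third Cantor set and let $\mathcal R:=\bigcup_{n,k\in\mathbb Z}3^{-n}(C+k)\subset\mathbb R$. There is a unique Borel measure $\nu$ on $\mathcal R$ with $\nu(C)=1$ that is invariant under translation by integers and satisfies $\int f(x)\,d\nu(x)=2^{-1}\int f(3^{-1}x)\,d\nu(x)$ for every Borel function $f:\mathcal R\to[0,\infty]$. Define unitary operators $D$ and $\lambda_k$ ($k\in\mathbb Z$) on $L^2(\mathcal R,\nu)$ by $(Df)(x)=2^{-1/2}f(3^{-1}x)$ and $(\lambda_kf)(x)=f(x-k)$. Let $m(z)=2^{-1/2}(1+z^2)$ for $z\in\mathbb T$. Let $\mathcal S_3:=\varprojlim(\mathbb T,z\mapsto z^3)=\{\zeta=(\zeta_n)_{n\ge 0}\in\mathbb T^{\mathbb N}:\zeta_{n+1}^3=\zeta_n\text{ for all }n\ge0\}$, with canonical maps $\pi_n(\zeta)=\zeta_n$ and shift $h(\zeta_0,\zeta_1,\dots)=(\zeta_0^3,\zeta_0,\zeta_1,\dots)$. There is a unique Borel probability measure $\tau$ on $\mathcal S_3$ such that $$\int_{\mathcal S_3}(f\circ\pi_n)\,d\tau=\int_{\mathbb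 T}f(z)\prod_{j=0}^{n-1}|m(z^{3^j})|^2\,dz\qquad\text{for all } n\ge 0 \text{ and } f\in C(\mathbb T),$$ where $dz$ is normalized Haar measure. There is a unitary isomorphism $\mathcal F$ of $L^2(\mathcal R,\nu)$ onto $L^2(\mathcal S_3,\tau)$ such that (a) $(\mathcal FD\mathcal F^*f)(\zeta)=m(\pi_0(\zeta))f(h(\zeta))$ for $f\in L^2(\mathcal S_3,\tau)$ and $\tau$-almost every $\zeta$; (b) $(\mathcal F\lambda_k\mathcal F^*f)(\zeta)=\pi_0(\zeta)^kf(\zeta)$ for $k\in\mathbb Z$, $f\in L^2(\mathcal S_3,\tau)$ and $\tau$-almost every $\zeta$; and (c) $\mathcal F(\chi_C)=1$. -/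

import Mathlib

open MeasureTheory
open scoped ENNReal

noncomputable section

namespace CantorSolenoid

/-! ### The filled-out Cantor set and its measure -/

/-- The set `R = ⋃ 3⁻ⁿ(C + k)`, the union over all integers `n` and `k`, where `C` is the
middle-third Cantor set in `[0, 1]`. -/
def filledCantor : Set ℝ :=
  ⋃ (n : ℤ) (k : ℤ), (fun x : ℝ => (3 : ℝ) ^ (-n) * (x + k)) '' cantorSet

theorem mem_filledCantor {x : ℝ} :
    x ∈ filledCantor ↔ ∃ n k : ℤ, ∃ c ∈ cantorSet, (3 : ℝ) ^ (-n) * (c + k) = x := by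
  simp [filledCantor]

theorem cantorSet_subset_filledCantor : cantorSet ⊆ filledCantor := fun x hx =>
  mem_filledCantor.2 ⟨0, 0, x, hx, by simp⟩

theorem zpow_mul_mem_filledCantor (j : ℤ) {x : ℝ} (hx : x ∈ filledCantor) :
    (3 : ℝ) ^ j * x ∈ filledCantor := by
  obtain ⟨n, k, c, hc, rfl⟩ := mem_filledCantor.1 hx
  refine mem_filledCantor.2 ⟨n - j, k, c, hc, ?_⟩
  rw [← mul_assoc, ← zpow_add₀ (by norm_num : (3 : ℝ) ≠ 0)]
  congr 2
  ring

/-- The scaling identity `3C = C ∪ (C + 2)`, iterated. -/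
theorem exists_pow_mul_cantor (p : ℕ) {c : ℝ} (hc : c ∈ cantorSet) :
    ∃ d ∈ cantorSet, ∃ j : ℤ, (3 : ℝ) ^ p * c = d + j := by
  induction p with
  | zero => exact ⟨c, hc, 0, by simp⟩
  | succ p ih =>
    obtain ⟨d, hd, j, h⟩ := ih
    rw [cantorSet_eq_union_halves] at hd
    rcases hd with ⟨e, he, rfl⟩ | ⟨e, he, rfl⟩
    · refine ⟨e, he, 3 * j, ?_⟩
      rw [pow_succ, mul_right_comm, h]
      push_cast
      ring
    · refine ⟨e, he, 3 * j + 2, ?_⟩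
      rw [pow_succ, mul_right_comm, h]
      push_cast
      ring

theorem add_int_mem_filledCantor (j : ℤ) {x : ℝ} (hx : x ∈ filledCantor) :
    x + j ∈ filledCantor := by
  obtain ⟨n, k, c, hc, rfl⟩ := mem_filledCantor.1 hx
  rcases le_total 0 n with hn | hn
  · lift n to ℕ using hn
    refine mem_filledCantor.2 ⟨n, k + 3 ^ n * j, c, hc, ?_⟩
    have h3 : (3 : ℝ) ^ n ≠ 0 := by positivity
    simp only [zpow_neg, zpow_natCast]
    push_cast
    field_simp
    ring
  · obtain ⟨p, hp⟩ := Int.eq_ofNat_of_zero_le (neg_nonneg.2 hn)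
    obtain ⟨d, hd, i, h⟩ := exists_pow_mul_cantor p hc
    refine mem_filledCantor.2 ⟨0, i + 3 ^ p * k + j, d, hd, ?_⟩
    rw [hp]
    simp only [neg_zero, zpow_zero, zpow_natCast]
    push_cast
    linear_combination -h

theorem third_mul_mem_filledCantor {x : ℝ} (hx : x ∈ filledCantor) : 3⁻¹ * x ∈ filledCantor := by
  simpa using zpow_mul_mem_filledCantor (-1) hx

theorem three_mul_mem_filledCantor {x : ℝ} (hx : x ∈ filledCantor) : 3 * x ∈ filledCantor := by
  simpa using zpow_mul_mem_filledCantor 1 hx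

/-- The map `x ↦ 3⁻¹x` of `R` onto itself. -/
def shrink : filledCantor ≃ᵐ filledCantor where
  toFun x := ⟨3⁻¹ * x, third_mul_mem_filledCantor x.2⟩
  invFun x := ⟨3 * x, three_mul_mem_filledCantor x.2⟩
  left_inv x := by ext; simp
  right_inv x := by ext; simp
  measurable_toFun := Measurable.subtype_mk (measurable_subtype_coe.const_mul _)
  measurable_invFun := Measurable.subtype_mk (measurable_subtype_coe.const_mul _)

/-- The translation `x ↦ x + k` of `R` by an integer `k`. -/
def translateBy (k : ℤ) : filledCantor ≃ᵐ filledCantor where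
  toFun x := ⟨x + k, add_int_mem_filledCantor k x.2⟩
  invFun x := ⟨x - k, by
    simpa [sub_eq_add_neg] using add_int_mem_filledCantor (-k) x.2⟩
  left_inv x := by ext; simp
  right_inv x := by ext; simp
  measurable_toFun := Measurable.subtype_mk (measurable_subtype_coe.add_const _)
  measurable_invFun := Measurable.subtype_mk (measurable_subtype_coe.sub_const _)

/-- The Cantor set `C` as a subset of `R`. -/
def cantorPart : Set filledCantor := Subtype.val ⁻¹' cantorSet

theorem measurableSet_cantorPart : MeasurableSet cantorPart :=
  measurable_subtype_coe isClosed_cantorSet.measurableSet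

/-- The defining properties of the measure `ν` on `R`: it is a Borel measure with `ν(C) = 1`, it is
invariant under translation by integers, and `∫ f(x) dν(x) = 2⁻¹ ∫ f(3⁻¹x) dν(x)`. The last identity
is imposed for nonnegative Borel functions with values in `[0, ∞]`, so it also says that `f` is
integrable if and only if `f(3⁻¹ ·)` is, and it gives the same formula for these functions. -/
structure IsCantorMeasure (ν : Measure filledCantor) : Prop where
  cantor : ν cantorPart = 1
  map_translateBy : ∀ k : ℤ, ν.map (translateBy k) = ν
  scaling : ∀ f : filledCantor → ℝ≥0∞, Measurable f →
    ∫⁻ x, f x ∂ν = 2⁻¹ * ∫⁻ x, f (shrink x) ∂ν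

section Operators

variable {ν : Measure filledCantor}

theorem IsCantorMeasure.cantor_ne_top (hν : IsCantorMeasure ν) : ν cantorPart ≠ ∞ := by
  simp [hν.cantor]

theorem IsCantorMeasure.map_shrink (hν : IsCantorMeasure ν) :
    ν.map shrink = (2 : ℝ≥0∞) • ν := by
  ext E hE
  have h := hν.scaling (E.indicator 1) (measurable_one.indicator hE)
  have h' : (fun x => E.indicator (1 : filledCantor → ℝ≥0∞) (shrink x)) =
      (shrink ⁻¹' E).indicator 1 := rfl
  rw [h', lintegral_indicator_one hE, lintegral_indicator_one (shrink.measurable hE)] at h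
  rw [Measure.map_apply shrink.measurable hE, Measure.smul_apply, h, smul_eq_mul, ← mul_assoc,
    ENNReal.mul_inv_cancel two_ne_zero ENNReal.ofNat_ne_top, one_mul]

theorem IsCantorMeasure.measurePreserving_shrink (hν : IsCantorMeasure ν) :
    MeasurePreserving shrink ν ((2 : ℝ≥0∞) • ν) :=
  ⟨shrink.measurable, hν.map_shrink⟩

theorem IsCantorMeasure.measurePreserving_shrink_symm (hν : IsCantorMeasure ν) :
    MeasurePreserving shrink.symm ((2 : ℝ≥0∞) • ν) ν :=
  hν.measurePreserving_shrink.symm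

theorem IsCantorMeasure.measurePreserving_translateBy (hν : IsCantorMeasure ν) (k : ℤ) :
    MeasurePreserving (translateBy k) ν ν :=
  ⟨(translateBy k).measurable, hν.map_translateBy k⟩

theorem ae_two_smul : ae ((2 : ℝ≥0∞) • ν) = ae ν :=
  Measure.ae_ennreal_smul_measure_eq two_ne_zero ν

theorem IsCantorMeasure.ae_shrink (hν : IsCantorMeasure ν) {p : filledCantor → Prop}
    (h : ∀ᵐ x ∂ν, p x) : ∀ᵐ x ∂ν, p (shrink x) := by
  refine hν.measurePreserving_shrink.quasiMeasurePreserving.ae ?_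
  rwa [ae_two_smul]

theorem IsCantorMeasure.ae_shrink_symm (hν : IsCantorMeasure ν) {p : filledCantor → Prop}
    (h : ∀ᵐ x ∂ν, p x) : ∀ᵐ x ∂ν, p (shrink.symm x) := by
  have := hν.measurePreserving_shrink_symm.quasiMeasurePreserving.ae h
  rwa [ae_two_smul] at this

theorem IsCantorMeasure.memLp_dilation (hν : IsCantorMeasure ν) (f : Lp ℂ 2 ν) :
    MemLp (fun x => ((Real.sqrt 2 : ℝ) : ℂ)⁻¹ * f (shrink x)) 2 ν :=
  (((Lp.memLp f).smul_measure ENNReal.ofNat_ne_top).comp_measurePreserving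
    hν.measurePreserving_shrink).const_mul _

theorem IsCantorMeasure.memLp_dilation_inv (hν : IsCantorMeasure ν) (f : Lp ℂ 2 ν) :
    MemLp (fun x => ((Real.sqrt 2 : ℝ) : ℂ) * f (shrink.symm x)) 2 ν := by
  have h : MemLp (fun x => ((Real.sqrt 2 : ℝ) : ℂ) * f (shrink.symm x)) 2 ((2 : ℝ≥0∞) • ν) :=
    ((Lp.memLp f).comp_measurePreserving hν.measurePreserving_shrink_symm).const_mul _
  have h2 := h.smul_measure (c := (2 : ℝ≥0∞)⁻¹) (by simp)
  rwa [smul_smul, ENNReal.inv_mul_cancel two_ne_zero ENNReal.ofNat_ne_top, one_smul] at h2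

theorem sqrt_two_ne_zero : ((Real.sqrt 2 : ℝ) : ℂ) ≠ 0 := by
  simp

/-- The unitary dilation operator `(Df)(x) = 2^{-1/2} f(3⁻¹x)` on `L²(R, ν)`. -/
def dilation (hν : IsCantorMeasure ν) : Lp ℂ 2 ν ≃ₗᵢ[ℂ] Lp ℂ 2 ν where
  toFun f := (hν.memLp_dilation f).toLp (fun x => ((Real.sqrt 2 : ℝ) : ℂ)⁻¹ * f (shrink x))
  invFun f := (hν.memLp_dilation_inv f).toLp (fun x => ((Real.sqrt 2 : ℝ) : ℂ) * f (shrink.symm x))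
  map_add' f g := by
    apply Lp.ext
    filter_upwards [(hν.memLp_dilation (f + g)).coeFn_toLp, (hν.memLp_dilation f).coeFn_toLp,
      (hν.memLp_dilation g).coeFn_toLp, hν.ae_shrink (Lp.coeFn_add f g),
      Lp.coeFn_add ((hν.memLp_dilation f).toLp _) ((hν.memLp_dilation g).toLp _)]
      with x h1 h2 h3 h4 h5
    rw [h1, h5, Pi.add_apply, h2, h3, h4, Pi.add_apply, mul_add]
  map_smul' c f := by
    apply Lp.ext
    filter_upwards [(hν.memLp_dilation (c • f)).coeFn_toLp, (hν.memLp_dilation f).coeFn_toLp,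
      hν.ae_shrink (Lp.coeFn_smul c f), Lp.coeFn_smul c ((hν.memLp_dilation f).toLp _)]
      with x h1 h2 h3 h4
    rw [h1, RingHom.id_apply, h4, Pi.smul_apply, h2, h3, Pi.smul_apply, smul_eq_mul, smul_eq_mul]
    ring
  left_inv f := by
    apply Lp.ext
    filter_upwards [(hν.memLp_dilation_inv ((hν.memLp_dilation f).toLp _)).coeFn_toLp,
      hν.ae_shrink_symm (hν.memLp_dilation f).coeFn_toLp] with x h1 h2
    rw [h1, h2, MeasurableEquiv.apply_symm_apply, mul_inv_cancel_left₀ sqrt_two_ne_zero]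
  right_inv f := by
    apply Lp.ext
    filter_upwards [(hν.memLp_dilation ((hν.memLp_dilation_inv f).toLp _)).coeFn_toLp,
      hν.ae_shrink (hν.memLp_dilation_inv f).coeFn_toLp] with x h1 h2
    rw [h1, h2, MeasurableEquiv.symm_apply_apply, inv_mul_cancel_left₀ sqrt_two_ne_zero]
  norm_map' f := by
    change ‖(hν.memLp_dilation f).toLp _‖ = ‖f‖
    rw [Lp.norm_toLp, Lp.norm_def]
    have h1 : eLpNorm (fun x => ((Real.sqrt 2 : ℝ) : ℂ)⁻¹ * f (shrink x)) 2 ν =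
        ‖((Real.sqrt 2 : ℝ) : ℂ)⁻¹‖ₑ * eLpNorm (f ∘ shrink) 2 ν :=
      eLpNorm_const_smul (((Real.sqrt 2 : ℝ) : ℂ)⁻¹) (f ∘ shrink) 2 ν
    rw [h1, eLpNorm_comp_measurePreserving ((Lp.aestronglyMeasurable f).smul_measure _)
      hν.measurePreserving_shrink, eLpNorm_smul_measure_of_ne_top ENNReal.ofNat_ne_top,
      smul_eq_mul, ← mul_assoc, ENNReal.toReal_mul, ENNReal.toReal_mul]
    have h2 : (‖((Real.sqrt 2 : ℝ) : ℂ)⁻¹‖ₑ).toReal * ((2 : ℝ≥0∞) ^ (1 / (2 : ℝ≥0∞)).toReal).toReal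
        = 1 := by
      rw [toReal_enorm, norm_inv, Complex.norm_real, Real.norm_of_nonneg (Real.sqrt_nonneg 2),
        ← ENNReal.toReal_rpow]
      have h3 : (2 : ℝ) ^ (2⁻¹ : ℝ) = Real.sqrt 2 := by
        rw [Real.sqrt_eq_rpow, one_div]
      simp [h3]
    rw [h2, one_mul]

theorem dilation_apply (hν : IsCantorMeasure ν) (f : Lp ℂ 2 ν) :
    dilation hν f =ᵐ[ν] fun x => ((Real.sqrt 2 : ℝ) : ℂ)⁻¹ * f (shrink x) :=
  (hν.memLp_dilation f).coeFn_toLp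

/-- The unitary translation operator `(λₖf)(x) = f(x - k)` on `L²(R, ν)`. -/
def translation (hν : IsCantorMeasure ν) (k : ℤ) : Lp ℂ 2 ν ≃ₗᵢ[ℂ] Lp ℂ 2 ν :=
  LinearIsometryEquiv.ofSurjective
    (Lp.compMeasurePreservingₗᵢ ℂ (translateBy (-k)) (hν.measurePreserving_translateBy (-k)))
    (by
      intro f
      refine ⟨Lp.compMeasurePreservingₗᵢ ℂ (translateBy k) (hν.measurePreserving_translateBy k) f, ?_⟩
      apply Lp.ext
      have h1 := Lp.coeFn_compMeasurePreserving f (hν.measurePreserving_translateBy k)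
      filter_upwards [Lp.coeFn_compMeasurePreserving
        (Lp.compMeasurePreserving (translateBy k) (hν.measurePreserving_translateBy k) f)
        (hν.measurePreserving_translateBy (-k)),
        (hν.measurePreserving_translateBy (-k)).quasiMeasurePreserving.ae h1] with x h2 h3
      refine h2.trans (h3.trans ?_)
      change f (translateBy k (translateBy (-k) x)) = f x
      congr 1
      ext
      simp [translateBy])

theorem translation_apply (hν : IsCantorMeasure ν) (k : ℤ) (f : Lp ℂ 2 ν) :
    translation hν k f =ᵐ[ν] fun x => f (translateBy (-k) x) :=
  Lp.coeFn_compMeasurePreserving f (hν.measurePreserving_translateBy (-k))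

end Operators

/-! ### The solenoid and its measure -/

/-- The filter `m(z) = 2^{-1/2}(1 + z²)` on the unit circle. -/
def cantorFilter (z : Circle) : ℂ := ((Real.sqrt 2 : ℝ) : ℂ)⁻¹ * (1 + (z : ℂ) ^ 2)

instance : MeasurableSpace Circle := borel Circle

instance : BorelSpace Circle := ⟨rfl⟩

/-- Haar measure on the unit circle, normalized to have total mass one. -/
def circleHaar : Measure Circle :=
  Measure.haarMeasure (⊤ : TopologicalSpace.PositiveCompacts Circle)

/-- The solenoid, i.e. the inverse limit of copies of the circle along the maps `z ↦ z³`; it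
carries the topology and the Borel structure of a subspace of the product. -/
abbrev Solenoid : Type := {ζ : ℕ → Circle // ∀ n, ζ (n + 1) ^ 3 = ζ n}

/-- The canonical map `πₙ` of the solenoid onto the `n`th copy of the circle. -/
def proj (n : ℕ) (ζ : Solenoid) : Circle := ζ.1 n

/-- The shift `h(ζ₀, ζ₁, …) = (ζ₀³, ζ₀, ζ₁, …)`. -/
def shift (ζ : Solenoid) : Solenoid :=
  ⟨fun n => Nat.casesOn n (ζ.1 0 ^ 3) ζ.1, fun n => by
    cases n with
    | zero => rfl
    | succ n => exact ζ.2 n⟩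

/-- The defining property of the measure `τ` on the solenoid: it is a Borel probability measure with
`∫ (f ∘ πₙ) dτ = ∫ f(z) ∏_{j < n} |m(z^{3^j})|² dz` for all `n` and all continuous `f`. -/
structure IsSolenoidMeasure (τ : Measure Solenoid) : Prop where
  isProbabilityMeasure : IsProbabilityMeasure τ
  integral_comp_proj : ∀ (n : ℕ) (f : C(Circle, ℂ)),
    ∫ ζ, f (proj n ζ) ∂τ =
      ∫ z, f z * ((∏ j ∈ Finset.range n, ‖cantorFilter (z ^ 3 ^ j)‖ ^ 2 : ℝ) : ℂ) ∂circleHaar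

end CantorSolenoid

end

open CantorSolenoid

open MeasureTheory Filter Topology
open scoped ENNReal InnerProductSpace NNReal

noncomputable section

namespace CantorSolenoid

/-! ### Unitaries from Gram matrices and the two-scale relation -/

section Hilbert

variable {H K : Type*} [NormedAddCommGroup H] [InnerProductSpace ℂ H]
  [NormedAddCommGroup K] [InnerProductSpace ℂ K]

/-! Both Hilbert spaces carry a family of vectors indexed by a scale n ≥ 0 and an integer k: on R
the normalized indicators of 3⁻ⁿ(C + k) (`pieceVec`), on the solenoid the functions ζₙᵏ / ∏_{j<n}
m(ζₙ^{3^j}) (`charVec`). Each family is orthonormal at every fixed scale and satisfies u n k =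
2^{-1/2}(u (n+1) (3k) + u (n+1) (3k+2)). On R this is the self-similarity C = C/3 ∪ (C + 2)/3; on
the solenoid it is the formula for m. These two properties (`IsCantorScaling`) determine every inner
product, because the coarser of two vectors can be refined to the scale of the other. So the Gram
matrices agree, and as both families are total, matching them defines the unitary F.

D lowers the scale by one and λⱼ replaces k by k + 3ⁿj. The weighted shift and multiplication by ζ₀ʲ
act on `charVec` in the same way, so (a) and (b) hold on total families and extend to all of L² by
`ae_eq_weighted_comp`; (c) is the case n = k = 0.

Totality on R and uniqueness of ν share one argument, `piece_inter_induction`: triadic rays cut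
pieces into smaller pieces, up to single points. Totality on the solenoid and uniqueness of τ both
use the uniform density of the span of the characters. For existence, ν is normalized Hausdorff
measure of dimension log 2 / log 3, and τ is a limit of measures with the right marginals, which are
consistent because |m|² has mean 1 over the fibres of z ↦ z³. -/

theorem inner_linearCombination {ι : Type*} (u : ι → H) (x y : ι →₀ ℂ) :
    ⟪Finsupp.linearCombination ℂ u x, Finsupp.linearCombination ℂ u y⟫_ℂ =
      x.sum fun i a => y.sum fun j b => starRingEnd ℂ a * (b * ⟪u i, u j⟫_ℂ) := by
  simp only [Finsupp.linearCombination_apply, Finsupp.sum, sum_inner, inner_sum, inner_smul_left,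
    inner_smul_right, Finset.mul_sum]
  rw [Finset.sum_comm]
  exact Finset.sum_congr rfl fun i _ => Finset.sum_congr rfl fun j _ => by ring

/-- Two total families with the same Gram matrix are related by a unitary operator. -/
theorem exists_unitary_of_gram_eq [CompleteSpace H] [CompleteSpace K] {ι : Type*}
    (u : ι → H) (v : ι → K)
    (hg : ∀ i j, ⟪u i, u j⟫_ℂ = ⟪v i, v j⟫_ℂ)
    (hu : (Submodule.span ℂ (Set.range u)).topologicalClosure = ⊤)
    (hv : (Submodule.span ℂ (Set.range v)).topologicalClosure = ⊤) :
    ∃ F : H ≃ₗᵢ[ℂ] K, ∀ i, F (u i) = v i := by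
  have hnorm : ∀ x : ι →₀ ℂ,
      ‖Finsupp.linearCombination ℂ v x‖ = ‖Finsupp.linearCombination ℂ u x‖ := fun x => by
    rw [@norm_eq_sqrt_re_inner ℂ, @norm_eq_sqrt_re_inner ℂ, inner_linearCombination,
      inner_linearCombination]
    simp only [hg]
  have du : DenseRange (Finsupp.linearCombination ℂ u) := by
    rw [DenseRange, ← LinearMap.coe_range, Finsupp.range_linearCombination]
    exact Submodule.dense_iff_topologicalClosure_eq_top.2 hu
  have dv : DenseRange (Finsupp.linearCombination ℂ v) := by
    rw [DenseRange, ← LinearMap.coe_range, Finsupp.range_linearCombination]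
    exact Submodule.dense_iff_topologicalClosure_eq_top.2 hv
  refine ⟨(LinearEquiv.refl ℂ (ι →₀ ℂ)).extendOfIsometry (Finsupp.linearCombination ℂ u)
    (Finsupp.linearCombination ℂ v) du dv hnorm, fun i => ?_⟩
  have h := LinearEquiv.extendOfIsometry_eq (LinearEquiv.refl ℂ (ι →₀ ℂ)) _ _ du dv hnorm
    (Finsupp.single i 1)
  simpa using h

/-- A multiscale family of vectors `u n k` satisfying the two-scale relation of the filter
`2^{-1/2}(1 + z²)` and orthonormal at each scale. -/
structure IsCantorScaling (u : ℕ → ℤ → H) : Prop where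
  orthonormal : ∀ n, Orthonormal ℂ (u n)
  refine_eq : ∀ n k, u n k =
    ((Real.sqrt 2 : ℝ) : ℂ)⁻¹ • (u (n + 1) (3 * k) + u (n + 1) (3 * k + 2))

/-- Refining the coarser vector d times reduces the inner product to inner products at the common
scale n + d, where orthonormality gives the same values in both spaces. -/
theorem IsCantorScaling.inner_eq {u : ℕ → ℤ → H} {v : ℕ → ℤ → K} (hu : IsCantorScaling u)
    (hv : IsCantorScaling v) (d n : ℕ) (k l : ℤ) :
    ⟪u n k, u (n + d) l⟫_ℂ = ⟪v n k, v (n + d) l⟫_ℂ := by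
  induction d generalizing n k with
  | zero =>
    rw [add_zero, orthonormal_iff_ite.1 (hu.orthonormal n), orthonormal_iff_ite.1 (hv.orthonormal n)]
  | succ d ih =>
    rw [hu.refine_eq n k, hv.refine_eq n k, ← add_assoc, add_right_comm]
    simp only [inner_smul_left, inner_add_left, ih]

theorem IsCantorScaling.gram_eq {u : ℕ → ℤ → H} {v : ℕ → ℤ → K} (hu : IsCantorScaling u)
    (hv : IsCantorScaling v) (i j : ℕ × ℤ) :
    ⟪u i.1 i.2, u j.1 j.2⟫_ℂ = ⟪v i.1 i.2, v j.1 j.2⟫_ℂ := by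
  rcases le_total i.1 j.1 with h | h
  · obtain ⟨d, hd⟩ := Nat.exists_eq_add_of_le h
    rw [hd]
    exact hu.inner_eq hv d _ _ _
  · obtain ⟨d, hd⟩ := Nat.exists_eq_add_of_le h
    rw [hd, ← inner_conj_symm, hu.inner_eq hv d, inner_conj_symm]

theorem IsCantorScaling.exists_unitary [CompleteSpace H] [CompleteSpace K] {u : ℕ → ℤ → H}
    {v : ℕ → ℤ → K} (hu : IsCantorScaling u)
    (hv : IsCantorScaling v)
    (hut : (Submodule.span ℂ (Set.range fun i : ℕ × ℤ => u i.1 i.2)).topologicalClosure = ⊤)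
    (hvt : (Submodule.span ℂ (Set.range fun i : ℕ × ℤ => v i.1 i.2)).topologicalClosure = ⊤) :
    ∃ F : H ≃ₗᵢ[ℂ] K, ∀ n k, F (u n k) = v n k := by
  obtain ⟨F, hF⟩ := exists_unitary_of_gram_eq (fun i : ℕ × ℤ => u i.1 i.2) (fun i => v i.1 i.2)
    (fun i j => hu.gram_eq hv i j) hut hvt
  exact ⟨F, fun n k => hF (n, k)⟩

end Hilbert

/-- A bounded operator on `L²` which is a weighted composition operator on a total family is one
everywhere. -/
theorem ae_eq_weighted_comp {X : Type*} [MeasurableSpace X] {μ : Measure X}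
    (T : Lp ℂ 2 μ →L[ℂ] Lp ℂ 2 μ) (w : X → ℂ) {h : X → X}
    (hh : Measure.QuasiMeasurePreserving h μ μ) {ι : Type*} (v : ι → Lp ℂ 2 μ)
    (hv : (Submodule.span ℂ (Set.range v)).topologicalClosure = ⊤)
    (hT : ∀ i, T (v i) =ᵐ[μ] fun x => w x * v i (h x)) (f : Lp ℂ 2 μ) :
    T f =ᵐ[μ] fun x => w x * f (h x) := by
  let S : Submodule ℂ (Lp ℂ 2 μ) :=
    { carrier := {f | T f =ᵐ[μ] fun x => w x * f (h x)}
      add_mem' := by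
        intro f g hf hg
        simp only [Set.mem_ofPred_eq] at hf hg ⊢
        rw [map_add]
        filter_upwards [hf, hg, Lp.coeFn_add (T f) (T g), hh.ae (Lp.coeFn_add f g)]
          with x h1 h2 h3 h4
        rw [h3, h4, Pi.add_apply, Pi.add_apply, h1, h2, mul_add]
      zero_mem' := by
        simp only [Set.mem_ofPred_eq, map_zero]
        filter_upwards [Lp.coeFn_zero ℂ 2 μ, hh.ae (Lp.coeFn_zero ℂ 2 μ)] with x h1 h2
        rw [h1, h2]
        simp
      smul_mem' := by
        intro c f hf
        simp only [Set.mem_ofPred_eq] at hf ⊢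
        rw [map_smul]
        filter_upwards [hf, Lp.coeFn_smul c (T f), hh.ae (Lp.coeFn_smul c f)] with x h1 h2 h3
        rw [h2, h3, Pi.smul_apply, Pi.smul_apply, h1, smul_eq_mul, smul_eq_mul]
        ring }
  have hS : IsClosed (S : Set (Lp ℂ 2 μ)) := by
    -- The weight is arbitrary, so f ↦ w · (f ∘ h) need not be continuous on L². Instead, pass to a
    -- subsequence along which both aₙ and T aₙ converge almost everywhere; quasi-invariance of h
    -- carries the first convergence to the points h x.
    refine IsSeqClosed.isClosed fun a g ha hg => ?_
    obtain ⟨φ, hφ, h1⟩ := (tendstoInMeasure_of_tendsto_Lp hg).exists_seq_tendsto_ae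
    obtain ⟨ψ, hψ, h2⟩ := (tendstoInMeasure_of_tendsto_Lp
      (((T.continuous.tendsto g).comp hg).comp hφ.tendsto_atTop)).exists_seq_tendsto_ae
    have h3 : ∀ᵐ x ∂μ, ∀ n, T (a n) x = w x * a n (h x) := ae_all_iff.2 ha
    change T g =ᵐ[μ] fun x => w x * g (h x)
    filter_upwards [hh.ae h1, h2, h3] with x e1 e2 e3
    refine tendsto_nhds_unique e2 ?_
    have := ((e1.comp hψ.tendsto_atTop).const_mul (w x))
    refine this.congr fun n => ?_
    simp [e3]
  have hle : (Submodule.span ℂ (Set.range v)).topologicalClosure ≤ S := by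
    refine Submodule.topologicalClosure_minimal _ (Submodule.span_le.2 ?_) hS
    rintro _ ⟨i, rfl⟩
    exact hT i
  rw [hv] at hle
  exact hle trivial

/-! ### The Hausdorff measure of the Cantor set -/

/-- The dimension `log 2 / log 3` of the Cantor set. -/
def cantorDim : ℝ≥0 := ⟨Real.log 2 / Real.log 3, by positivity⟩

theorem cantorDim_pos : 0 < cantorDim := by
  have : 0 < Real.log 2 / Real.log 3 :=
    div_pos (Real.log_pos (by norm_num)) (Real.log_pos (by norm_num))
  exact this

theorem three_rpow_cantorDim : (3 : ℝ) ^ (cantorDim : ℝ) = 2 := by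
  have h3 : Real.log 3 ≠ 0 := (Real.log_pos (by norm_num)).ne'
  rw [Real.rpow_def_of_pos (by norm_num)]
  change Real.exp (Real.log 3 * (Real.log 2 / Real.log 3)) = 2
  rw [mul_div_cancel₀ _ h3, Real.exp_log (by norm_num)]

theorem inv_three_pow_rpow_cantorDim (n : ℕ) :
    (((3 : ℝ) ^ n)⁻¹) ^ (cantorDim : ℝ) = ((2 : ℝ) ^ n)⁻¹ := by
  rw [Real.inv_rpow (by positivity), ← Real.rpow_natCast, ← Real.rpow_mul (by norm_num),
    mul_comm, Real.rpow_mul (by norm_num), three_rpow_cantorDim, Real.rpow_natCast]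

/-- The Cantor function, on the Cantor set. -/
def cantorFun (x : ℝ) : ℝ :=
  Real.ofDigits (fun i => cond ((cantorToBinary x).get i) (1 : Fin 2) 0)

/-- The ternary digits are 0 or 2, so at the first disagreement the expansions differ by 2 ·
3^{-(n+1)}, and the tails recover at most 3^{-(n+1)} of this. -/
theorem abs_sub_cantor_ge {x y : ℝ} (hx : x ∈ cantorSet) (hy : y ∈ cantorSet) {n : ℕ}
    (h : ∀ i < n, (cantorToBinary x).get i = (cantorToBinary y).get i)
    (hn : (cantorToBinary x).get n ≠ (cantorToBinary y).get n) :
    ((3 : ℝ) ^ (n + 1))⁻¹ ≤ |x - y| := by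
  wlog hw : (cantorToBinary x).get n = true generalizing x y
  · rw [abs_sub_comm]
    exact this hy hx (fun i hi => (h i hi).symm) hn.symm (by grind)
  have hy' : (cantorToBinary y).get n = false := by grind
  have hax : (cantorToTernary x).get n = 2 := by
    rw [cantorToTernary, Stream'.get_map, hw, cond_true]
  have hay : (cantorToTernary y).get n = 0 := by
    rw [cantorToTernary, Stream'.get_map, hy', cond_false]
  have hsum : ∑ i ∈ Finset.range n, Real.ofDigitsTerm (cantorToTernary x).get i =
      ∑ i ∈ Finset.range n, Real.ofDigitsTerm (cantorToTernary y).get i := by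
    refine Finset.sum_congr rfl fun i hi => ?_
    simp only [Real.ofDigitsTerm, cantorToTernary, Stream'.get_map]
    rw [h i (Finset.mem_range.1 hi)]
  have ex := Real.ofDigits_eq_sum_add_ofDigits (cantorToTernary x).get (n + 1)
  have ey := Real.ofDigits_eq_sum_add_ofDigits (cantorToTernary y).get (n + 1)
  rw [ofDigits_cantorToTernary hx, Finset.sum_range_succ, hsum] at ex
  rw [ofDigits_cantorToTernary hy, Finset.sum_range_succ] at ey
  simp only [Real.ofDigitsTerm, hax, hay] at ex ey
  have h1 := Real.ofDigits_nonneg (fun i => (cantorToTernary x).get (i + (n + 1)))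
  have h2 := Real.ofDigits_le_one (fun i => (cantorToTernary y).get (i + (n + 1)))
  have h3 : (0 : ℝ) < ((3 : ℝ) ^ (n + 1))⁻¹ := by positivity
  have e1 := mul_nonneg h3.le h1
  have e2 := mul_le_mul_of_nonneg_left h2 h3.le
  refine le_trans ?_ (le_abs_self _)
  have c2 : (((2 : Fin 3) : ℕ) : ℝ) = 2 := by norm_num
  have c0 : (((0 : Fin 3) : ℕ) : ℝ) = 0 := by norm_num
  rw [c2] at ex
  rw [c0] at ey
  push_cast at ex ey
  linarith

/-- If the digits first differ at place n, the values differ by at most 2⁻ⁿ, while |x - y|^dim ≥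
2^{-(n+1)}; the off-by-one in the exponent is the Hölder constant 2. -/
theorem holderOnWith_cantorFun : HolderOnWith 2 cantorDim cantorFun cantorSet := by
  intro x hx y hy
  by_cases hxy : ∀ i, (cantorToBinary x).get i = (cantorToBinary y).get i
  · have : cantorFun x = cantorFun y := by simp only [cantorFun, hxy]
    rw [this, edist_self]
    exact zero_le
  · push Not at hxy
    have hn := Nat.find_spec hxy
    have hlt : ∀ i < Nat.find hxy, (cantorToBinary x).get i = (cantorToBinary y).get i :=
      fun i hi => by simpa using Nat.find_min hxy hi
    set n := Nat.find hxy
    have h1 := abs_sub_cantor_ge hx hy hlt hn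
    have h2 : |cantorFun x - cantorFun y| ≤ (((2 : ℕ) : ℝ) ^ n)⁻¹ :=
      Real.abs_ofDigits_sub_ofDigits_le fun i hi => by rw [hlt i hi]
    have h3 : |cantorFun x - cantorFun y| ≤ 2 * |x - y| ^ (cantorDim : ℝ) := by
      have h4 := Real.rpow_le_rpow (by positivity) h1 cantorDim.coe_nonneg
      rw [inv_three_pow_rpow_cantorDim, pow_succ, mul_inv] at h4
      push_cast at h2
      linarith
    rw [edist_dist, edist_dist, Real.dist_eq, Real.dist_eq,
      ENNReal.ofReal_rpow_of_nonneg (abs_nonneg _) cantorDim.coe_nonneg,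
      show ((2 : ℝ≥0) : ℝ≥0∞) = ENNReal.ofReal 2 by simp, ← ENNReal.ofReal_mul (by norm_num)]
    exact ENNReal.ofReal_le_ofReal h3

theorem Icc_subset_cantorFun_image : Set.Icc 0 1 ⊆ cantorFun '' cantorSet := by
  intro y hy
  obtain ⟨a, -, ha⟩ := Real.ofDigits_SurjOn (b := 2) (by norm_num) hy
  let b : ℕ → Bool := fun i => decide (a i = 1)
  refine ⟨(cantorSetEquivNatToBool.symm b : ℝ), Subtype.coe_prop _, ?_⟩
  have hb : (cantorToBinary (cantorSetEquivNatToBool.symm b : ℝ)).get = b :=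
    cantorSetEquivNatToBool.apply_symm_apply b
  rw [cantorFun, ← ha]
  congr 1
  ext1 i
  rw [congrFun hb i]
  generalize h : a i = c
  fin_cases c <;> simp [b, h]

/-- A Hölder map of exponent `cantorDim` sends sets of zero `cantorDim`-dimensional measure to
Lebesgue null sets, but the Cantor function maps C onto a set containing [0, 1]. -/
theorem hausdorffMeasure_cantorSet_ne_zero : μH[(cantorDim : ℝ)] cantorSet ≠ 0 := by
  intro h0
  have h := holderOnWith_cantorFun.hausdorffMeasure_image_le cantorDim_pos zero_le_one
  rw [mul_one, h0, mul_zero] at h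
  have h1 := (measure_mono (μ := μH[1]) Icc_subset_cantorFun_image).trans h
  rw [hausdorffMeasure_real] at h1
  simp at h1

/-- These are the intervals of the n-th construction stage. Under y ↦ y/3 and y ↦ (2 + y)/3 the
numerator a becomes a and a + 2 · 3ⁿ over the denominator 3ⁿ⁺¹, so their number at most doubles. -/
theorem exists_cover_cantorSet (n : ℕ) : ∃ s : Finset ℤ, s.card ≤ 2 ^ n ∧
    cantorSet ⊆ ⋃ a : s, Set.Icc ((a : ℝ) / 3 ^ n) ((a : ℝ) / 3 ^ n + (3 ^ n)⁻¹) := by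
  induction n with
  | zero =>
    refine ⟨{0}, by simp, fun x hx => ?_⟩
    simpa using cantorSet_subset_unitInterval hx
  | succ n ih =>
    obtain ⟨s, hs, h⟩ := ih
    refine ⟨s ∪ s.image (· + 2 * 3 ^ n), ?_, fun x hx => ?_⟩
    · refine (Finset.card_union_le _ _).trans ?_
      have := Finset.card_image_le (s := s) (f := (· + 2 * 3 ^ n))
      rw [pow_succ]
      omega
    · have h3 : (0 : ℝ) < 3 ^ n := by positivity
      rw [cantorSet_eq_union_halves] at hx
      simp only [Set.mem_iUnion, Subtype.exists, exists_prop] at h ⊢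
      rcases hx with ⟨y, hy, rfl⟩ | ⟨y, hy, rfl⟩
      · obtain ⟨⟨a, ha⟩, h1, h2⟩ := Set.mem_iUnion.1 (h hy)
        refine ⟨a, by simp [ha], ?_, ?_⟩
        · refine le_trans (le_of_eq ?_) (div_le_div_of_nonneg_right h1 (by norm_num))
          field_simp
          ring
        · refine (div_le_div_of_nonneg_right h2 (by norm_num)).trans (le_of_eq ?_)
          field_simp
          ring
      · obtain ⟨⟨a, ha⟩, h1, h2⟩ := Set.mem_iUnion.1 (h hy)
        refine ⟨a + 2 * 3 ^ n, by simp [ha], ?_, ?_⟩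
        · refine le_trans (le_of_eq ?_)
            (div_le_div_of_nonneg_right (add_le_add_right h1 2) (by norm_num))
          push_cast
          field_simp
          ring
        · refine (div_le_div_of_nonneg_right (add_le_add_right h2 2) (by norm_num)).trans
            (le_of_eq ?_)
          push_cast
          field_simp
          ring

/-- At stage n at most 2ⁿ intervals of length 3⁻ⁿ are used, and each contributes (3⁻ⁿ)^dim = 2⁻ⁿ. -/
theorem hausdorffMeasure_cantorSet_le_one : μH[(cantorDim : ℝ)] cantorSet ≤ 1 := by
  choose s hs hcov using exists_cover_cantorSet
  have hdiam : ∀ n (a : s n), Metric.ediam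
      (Set.Icc ((a : ℝ) / 3 ^ n) ((a : ℝ) / 3 ^ n + (3 ^ n)⁻¹)) = ENNReal.ofReal ((3 ^ n)⁻¹) := by
    intro n a
    rw [Real.ediam_Icc]
    congr 1
    ring
  have hr : Tendsto (fun n : ℕ => ENNReal.ofReal (((3 : ℝ) ^ n)⁻¹)) atTop (𝓝 0) := by
    have h := ENNReal.tendsto_ofReal
      (tendsto_pow_atTop_nhds_zero_of_lt_one (r := (3 : ℝ)⁻¹) (by norm_num) (by norm_num))
    simpa using h
  refine (Measure.hausdorffMeasure_le_liminf_sum (cantorDim : ℝ) cantorSet _ hr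
    (fun n (a : s n) => Set.Icc ((a : ℝ) / 3 ^ n) ((a : ℝ) / 3 ^ n + (3 ^ n)⁻¹))
    (Eventually.of_forall fun n a => (hdiam n a).le) (Eventually.of_forall hcov)).trans ?_
  refine liminf_le_of_le (by isBoundedDefault) fun b hb => ?_
  obtain ⟨n, hn⟩ := hb.exists
  refine hn.trans ?_
  simp only [hdiam, Finset.sum_const, Finset.card_univ, Fintype.card_coe]
  rw [ENNReal.ofReal_rpow_of_nonneg (by positivity) cantorDim.coe_nonneg]
  rw [inv_three_pow_rpow_cantorDim, nsmul_eq_mul]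
  calc ((s n).card : ℝ≥0∞) * ENNReal.ofReal ((2 ^ n)⁻¹)
      ≤ (2 : ℝ≥0∞) ^ n * ENNReal.ofReal ((2 ^ n)⁻¹) := by
        gcongr
        exact_mod_cast hs n
    _ = 1 := by
        rw [show (2 : ℝ≥0∞) ^ n = ENNReal.ofReal (2 ^ n) by simp, ← ENNReal.ofReal_mul (by positivity),
          mul_inv_cancel₀ (by positivity), ENNReal.ofReal_one]

/-! ### Existence of the measure on the filled-out Cantor set -/

theorem hausdorffMeasure_cantorPart :
    μH[(cantorDim : ℝ)] cantorPart = μH[(cantorDim : ℝ)] cantorSet := by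
  rw [← isometry_subtype_coe.hausdorffMeasure_image (Or.inl cantorDim.coe_nonneg)]
  congr 1
  rw [cantorPart, Subtype.image_preimage_coe]
  exact Set.inter_eq_right.2 cantorSet_subset_filledCantor

theorem map_translateBy_hausdorffMeasure (k : ℤ) (d : ℝ) :
    (μH[d] : Measure filledCantor).map (translateBy k) = μH[d] := by
  have h : Isometry (translateBy k) := Isometry.of_dist_eq fun x y => by
    simp [translateBy, Subtype.dist_eq]
  exact (IsometryEquiv.mk (translateBy k).toEquiv h).map_hausdorffMeasure d

/-- The map and its inverse are Lipschitz with constants 1/3 and 3, and 3^dim = 2, so the two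
Lipschitz bounds on Hausdorff measure meet. -/
theorem map_shrink_hausdorffMeasure :
    (μH[(cantorDim : ℝ)] : Measure filledCantor).map shrink =
      (2 : ℝ≥0∞) • μH[(cantorDim : ℝ)] := by
  have h1 : LipschitzWith 3 shrink.symm := LipschitzWith.of_dist_le_mul fun x y => by
    change dist ((3 : ℝ) * x) (3 * y) ≤ _
    rw [Subtype.dist_eq, Real.dist_eq, Real.dist_eq, ← mul_sub, abs_mul]
    simp
  have h2 : LipschitzWith 3⁻¹ shrink := LipschitzWith.of_dist_le_mul fun x y => by
    change dist ((3⁻¹ : ℝ) * x) (3⁻¹ * y) ≤ _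
    rw [Subtype.dist_eq, Real.dist_eq, Real.dist_eq, ← mul_sub, abs_mul]
    simp
  have e1 : (((3 : ℝ≥0) : ℝ≥0∞)) ^ (cantorDim : ℝ) = 2 := by
    rw [show ((3 : ℝ≥0) : ℝ≥0∞) = ENNReal.ofReal 3 by simp,
      ENNReal.ofReal_rpow_of_nonneg (by norm_num) cantorDim.coe_nonneg]
    rw [three_rpow_cantorDim]
    simp
  have e2 : (((3⁻¹ : ℝ≥0) : ℝ≥0∞)) ^ (cantorDim : ℝ) = 2⁻¹ := by
    rw [ENNReal.coe_inv (by norm_num), ENNReal.inv_rpow, e1]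
  ext E hE
  rw [Measure.map_apply shrink.measurable hE, Measure.smul_apply, smul_eq_mul]
  apply le_antisymm
  · have h := h1.hausdorffMeasure_image_le cantorDim.coe_nonneg E
    rw [shrink.symm.image_eq_preimage_symm] at h
    refine h.trans_eq ?_
    rw [e1]
  · have h := h2.hausdorffMeasure_image_le cantorDim.coe_nonneg (shrink ⁻¹' E)
    rw [Set.image_preimage_eq _ shrink.surjective] at h
    rw [e2] at h
    calc 2 * μH[(cantorDim : ℝ)] E ≤ 2 * (2⁻¹ * μH[(cantorDim : ℝ)] (shrink ⁻¹' E)) := by gcongr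
      _ = _ := by
        rw [← mul_assoc, ENNReal.mul_inv_cancel two_ne_zero ENNReal.ofNat_ne_top, one_mul]

/-- Hausdorff measure already has the invariance and the scaling; its value on C is positive and
finite, so it can be normalized. -/
theorem exists_isCantorMeasure : ∃ ν : Measure filledCantor, IsCantorMeasure ν := by
  have h0 := hausdorffMeasure_cantorSet_ne_zero
  have h1 := (hausdorffMeasure_cantorSet_le_one.trans_lt ENNReal.one_lt_top).ne
  refine ⟨(μH[(cantorDim : ℝ)] cantorSet)⁻¹ • μH[(cantorDim : ℝ)], ?_, fun k => ?_, fun f hf => ?_⟩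
  · rw [Measure.smul_apply, hausdorffMeasure_cantorPart, smul_eq_mul, ENNReal.inv_mul_cancel h0 h1]
  · rw [Measure.map_smul, map_translateBy_hausdorffMeasure]
  · rw [lintegral_smul_measure, lintegral_smul_measure, ← lintegral_map_equiv f shrink,
      map_shrink_hausdorffMeasure, lintegral_smul_measure]
    simp only [smul_eq_mul]
    rw [mul_left_comm, ← mul_assoc 2⁻¹, ENNReal.inv_mul_cancel two_ne_zero ENNReal.ofNat_ne_top,
      one_mul]

/-! ### The pieces `3⁻ⁿ(C + k)` of the filled-out Cantor set -/

/-- The piece `3⁻ⁿ(C + k)` of `R`. -/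
def piece (n : ℕ) (k : ℤ) : Set filledCantor := {x | (3 : ℝ) ^ n * x - k ∈ cantorSet}

theorem measurableSet_piece (n : ℕ) (k : ℤ) : MeasurableSet (piece n k) :=
  ((measurable_subtype_coe.const_mul _).sub_const _) isClosed_cantorSet.measurableSet

theorem piece_zero_zero : piece 0 0 = cantorPart := by
  ext x
  simp [piece, cantorPart]

theorem shrink_preimage_piece (n : ℕ) (k : ℤ) : shrink ⁻¹' piece (n + 1) k = piece n k := by
  ext x
  change (3 : ℝ) ^ (n + 1) * (3⁻¹ * x) - k ∈ cantorSet ↔ (3 : ℝ) ^ n * x - k ∈ cantorSet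
  rw [pow_succ, mul_assoc, mul_inv_cancel_left₀ (by norm_num)]

theorem translateBy_preimage_piece (n : ℕ) (j k : ℤ) :
    translateBy j ⁻¹' piece n k = piece n (k - 3 ^ n * j) := by
  ext x
  change (3 : ℝ) ^ n * (x + j) - k ∈ cantorSet ↔
    (3 : ℝ) ^ n * x - ((k - 3 ^ n * j : ℤ) : ℝ) ∈ cantorSet
  push_cast
  rw [show (3 : ℝ) ^ n * (x + j) - k = (3 : ℝ) ^ n * x - (k - 3 ^ n * j) by ring]

theorem mem_cantorSet_iff_three_mul {y : ℝ} :
    y ∈ cantorSet ↔ 3 * y ∈ cantorSet ∨ 3 * y - 2 ∈ cantorSet := by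
  conv_lhs => rw [cantorSet_eq_union_halves]
  constructor
  · rintro (⟨c, hc, rfl⟩ | ⟨c, hc, rfl⟩)
    · left
      rwa [mul_div_cancel₀ _ (by norm_num)]
    · right
      rwa [mul_div_cancel₀ _ (by norm_num), add_sub_cancel_left]
  · rintro (h | h)
    · exact Or.inl ⟨_, h, by ring⟩
    · exact Or.inr ⟨_, h, by ring⟩

/-- The self-similarity of C at scale n; it is the source of the two-scale relation for `pieceVec`.
-/
theorem piece_eq_union (n : ℕ) (k : ℤ) :
    piece n k = piece (n + 1) (3 * k) ∪ piece (n + 1) (3 * k + 2) := by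
  ext x
  change (3 : ℝ) ^ n * x - k ∈ cantorSet ↔ (3 : ℝ) ^ (n + 1) * x - ((3 * k : ℤ) : ℝ) ∈ cantorSet ∨
    (3 : ℝ) ^ (n + 1) * x - ((3 * k + 2 : ℤ) : ℝ) ∈ cantorSet
  rw [mem_cantorSet_iff_three_mul]
  push_cast
  rw [show 3 * ((3 : ℝ) ^ n * x - k) = 3 ^ (n + 1) * x - 3 * k by ring, sub_sub]

theorem le_of_mem_piece {n : ℕ} {k : ℤ} {x : filledCantor} (hx : x ∈ piece n k) :
    (k : ℝ) ≤ 3 ^ n * x ∧ (3 : ℝ) ^ n * x ≤ k + 1 := by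
  obtain ⟨h1, h2⟩ := cantorSet_subset_unitInterval hx
  constructor <;> linarith

theorem disjoint_piece (n : ℕ) (k : ℤ) :
    Disjoint (piece (n + 1) (3 * k)) (piece (n + 1) (3 * k + 2)) := by
  refine Set.disjoint_left.2 fun x h1 h2 => ?_
  have e1 := (le_of_mem_piece h1).2
  have e2 := (le_of_mem_piece h2).1
  push_cast at e1 e2
  linarith

/-- Scales n ≥ 0 suffice: an enlarged copy 3ᵖ(C + k) is covered by integer translates of C. -/
theorem exists_mem_piece (x : filledCantor) : ∃ n k, x ∈ piece n k := by
  obtain ⟨n, k, c, hc, h⟩ := mem_filledCantor.1 x.2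
  rcases le_total 0 n with hn | hn
  · lift n to ℕ using hn
    refine ⟨n, k, ?_⟩
    change (3 : ℝ) ^ n * (x : ℝ) - k ∈ cantorSet
    rwa [← h, zpow_neg, zpow_natCast, mul_inv_cancel_left₀ (by positivity), add_sub_cancel_right]
  · obtain ⟨p, hp⟩ := Int.eq_ofNat_of_zero_le (neg_nonneg.2 hn)
    obtain ⟨d, hd, j, hj⟩ := exists_pow_mul_cantor p hc
    refine ⟨0, 3 ^ p * k + j, ?_⟩
    change (3 : ℝ) ^ 0 * (x : ℝ) - ((3 ^ p * k + j : ℤ) : ℝ) ∈ cantorSet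
    rw [← h, hp, zpow_natCast]
    push_cast
    rwa [pow_zero, one_mul, mul_add, hj,
      show d + (j : ℝ) + 3 ^ p * (k : ℝ) - (3 ^ p * k + j) = d by ring]

theorem iUnion_piece : ⋃ i : ℕ × ℤ, piece i.1 i.2 = Set.univ :=
  Set.eq_univ_of_forall fun x =>
    let ⟨n, k, h⟩ := exists_mem_piece x
    Set.mem_iUnion.2 ⟨(n, k), h⟩

theorem exists_mem_piece_add {n : ℕ} {k : ℤ} {x : filledCantor} (hx : x ∈ piece n k) (m : ℕ) :
    ∃ l, x ∈ piece (n + m) l := by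
  induction m with
  | zero => exact ⟨k, hx⟩
  | succ m ih =>
    obtain ⟨l, hl⟩ := ih
    rw [piece_eq_union] at hl
    rcases hl with h | h
    · exact ⟨_, h⟩
    · exact ⟨_, h⟩

/-! ### A π-system adapted to the pieces -/

/-- The sets `{x | 3ᵐ x < j}`, which generate the Borel sets of `R`. -/
def triadicRays : Set (Set filledCantor) :=
  Set.range fun i : ℕ × ℤ => {x : filledCantor | (3 : ℝ) ^ i.1 * x < i.2}

theorem isPiSystem_triadicRays : IsPiSystem triadicRays := by
  rintro _ ⟨⟨m, j⟩, rfl⟩ _ ⟨⟨m', j'⟩, rfl⟩ -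
  have key : ∀ (m : ℕ) (j : ℤ) (x : ℝ), (3 : ℝ) ^ m * x < j ↔ x < j / 3 ^ m := fun m j x => by
    rw [lt_div_iff₀ (by positivity), mul_comm]
  simp only [key]
  rcases le_total ((j : ℝ) / 3 ^ m) (j' / 3 ^ m') with h | h
  · refine ⟨(m, j), ?_⟩
    ext x
    simp only [key, Set.mem_ofPred_eq, Set.mem_inter_iff]
    exact ⟨fun hx => ⟨hx, hx.trans_le h⟩, fun hx => hx.1⟩
  · refine ⟨(m', j'), ?_⟩
    ext x
    simp only [key, Set.mem_ofPred_eq, Set.mem_inter_iff]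
    exact ⟨fun hx => ⟨hx.trans_le h, hx⟩, fun hx => hx.2⟩

theorem measurableSet_triadicRays {E : Set filledCantor} (hE : E ∈ triadicRays) :
    MeasurableSet E := by
  obtain ⟨i, rfl⟩ := hE
  exact measurableSet_lt (measurable_subtype_coe.const_mul _) measurable_const

theorem generateFrom_triadicRays :
    (inferInstance : MeasurableSpace filledCantor) = MeasurableSpace.generateFrom triadicRays := by
  apply le_antisymm
  · change MeasurableSpace.comap Subtype.val (borel ℝ) ≤ _
    rw [borel_eq_generateFrom_Iio, MeasurableSpace.comap_generateFrom]
    refine MeasurableSpace.generateFrom_le ?_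
    rintro _ ⟨_, ⟨t, rfl⟩, rfl⟩
    -- The triadic numbers ⌊3ᵐt⌋/3ᵐ approximate t from below within 3⁻ᵐ.
    have h : (Subtype.val ⁻¹' Set.Iio t : Set filledCantor) =
        ⋃ m : ℕ, {x : filledCantor | (3 : ℝ) ^ m * x < (⌊(3 : ℝ) ^ m * t⌋ : ℤ)} := by
      ext x
      simp only [Set.mem_preimage, Set.mem_Iio, Set.mem_iUnion, Set.mem_ofPred_eq]
      constructor
      · intro hx
        obtain ⟨m, hm⟩ := pow_unbounded_of_one_lt (t - x)⁻¹ (by norm_num : (1 : ℝ) < 3)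
        refine ⟨m, ?_⟩
        have h1 := Int.sub_one_lt_floor ((3 : ℝ) ^ m * t)
        have h2 : 1 < (3 : ℝ) ^ m * (t - x) := (inv_lt_iff_one_lt_mul₀ (sub_pos.2 hx)).1 hm
        linarith
      · rintro ⟨m, hm⟩
        exact lt_of_mul_lt_mul_left (hm.trans_le (Int.floor_le _)) (by positivity)
    rw [h]
    exact .iUnion fun m => MeasurableSpace.measurableSet_generateFrom ⟨(m, _), rfl⟩
  · refine MeasurableSpace.generateFrom_le ?_
    exact fun E hE => measurableSet_triadicRays hE

/-- A property of subsets of `R` that holds for the pieces and passes to disjoint unions and to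
sets that differ in one point holds for the intersections of pieces with the generating rays. -/
theorem piece_inter_induction {Φ : Set filledCantor → Prop} (empty : Φ ∅)
    (mem : ∀ n k, Φ (piece n k))
    (union : ∀ A B, MeasurableSet A → MeasurableSet B → Disjoint A B → Φ A → Φ B → Φ (A ∪ B))
    (diff : ∀ A B x, A \ {x} = B \ {x} → Φ A → Φ B) (n : ℕ) (k : ℤ)
    {E : Set filledCantor} (hE : E ∈ triadicRays) : Φ (piece n k ∩ E) := by
  obtain ⟨⟨m, j⟩, rfl⟩ := hE
  -- Induction on how much finer the ray is than the piece. Each step splits the piece into its two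
  -- children, until both have the same scale.
  have key : ∀ d n k (j : ℤ), Φ (piece n k ∩ {x : filledCantor | (3 : ℝ) ^ (n + d) * x < j}) := by
    intro d
    induction d with
    | zero =>
      intro n k j
      rw [add_zero]
      -- At equal scale the piece lies between k and k + 1 and the ray ends at the integer j, so the
      -- ray misses the piece or contains all of it except possibly the point 3⁻ⁿj.
      rcases le_or_gt j k with h | h
      · convert empty
        refine Set.eq_empty_of_forall_notMem fun x hx => ?_
        have h1 := (le_of_mem_piece hx.1).1
        have h2 : (3 : ℝ) ^ n * x < j := hx.2
        have h3 : (j : ℝ) ≤ k := by exact_mod_cast h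
        linarith
      · have h3 : (k : ℝ) + 1 ≤ j := by exact_mod_cast h
        by_cases hp : ∃ p : filledCantor, (3 : ℝ) ^ n * p = j
        · obtain ⟨p, hp⟩ := hp
          refine diff _ _ p ?_ (mem n k)
          ext x
          simp only [Set.mem_sdiff, Set.mem_inter_iff, Set.mem_ofPred_eq, Set.mem_singleton_iff]
          constructor
          · rintro ⟨h1, h2⟩
            refine ⟨⟨h1, lt_of_le_of_ne ((le_of_mem_piece h1).2.trans h3) fun h4 => h2 ?_⟩, h2⟩
            rw [← hp] at h4
            exact Subtype.ext (mul_left_cancel₀ (by positivity) h4)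
          · rintro ⟨⟨h1, -⟩, h2⟩
            exact ⟨h1, h2⟩
        · convert mem n k
          refine Set.inter_eq_left.2 fun x h1 => ?_
          exact lt_of_le_of_ne ((le_of_mem_piece h1).2.trans h3) fun h4 => hp ⟨x, h4⟩
    | succ d ih =>
      intro n k j
      have hm : MeasurableSet {x : filledCantor | (3 : ℝ) ^ (n + (d + 1)) * x < j} :=
        measurableSet_triadicRays ⟨(n + (d + 1), j), rfl⟩
      rw [piece_eq_union, Set.union_inter_distrib_right]
      refine union _ _ ((measurableSet_piece _ _).inter hm) ((measurableSet_piece _ _).inter hm)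
        ((disjoint_piece n k).mono Set.inter_subset_left Set.inter_subset_left) ?_ ?_
      · have := ih (n + 1) (3 * k) j
        rwa [add_right_comm] at this
      · have := ih (n + 1) (3 * k + 2) j
        rwa [add_right_comm] at this
  -- The ray is rewritten as 3ⁿ⁺ᵐx < 3ⁿj, so that its scale is at least that of the piece.
  have h := key m n k (3 ^ n * j)
  convert h using 4 with x
  push_cast
  rw [pow_add, mul_assoc, mul_lt_mul_iff_right₀ (by positivity)]

/-! ### Uniqueness of the measure -/

section Measure

variable {ν : Measure filledCantor}

/-- Translations reduce scale 0 to C itself; the preimage of a piece under `shrink` is a piece one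
scale coarser, which has twice the measure. -/
theorem IsCantorMeasure.measure_piece (hν : IsCantorMeasure ν) (n : ℕ) (k : ℤ) :
    ν (piece n k) = (2 ^ n)⁻¹ := by
  induction n with
  | zero =>
    have h : piece 0 k = translateBy (-k) ⁻¹' piece 0 0 := by
      rw [translateBy_preimage_piece]
      congr 1
      ring
    rw [h, (hν.measurePreserving_translateBy (-k)).measure_preimage
      (measurableSet_piece 0 0).nullMeasurableSet, piece_zero_zero, hν.cantor]
    simp
  | succ n ih =>
    rw [← shrink_preimage_piece, hν.measurePreserving_shrink.measure_preimage
      (measurableSet_piece _ _).nullMeasurableSet, Measure.smul_apply, smul_eq_mul] at ih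
    rw [pow_succ, ENNReal.mul_inv (by simp) (by simp), ← ih, mul_comm, ← mul_assoc,
      ENNReal.inv_mul_cancel two_ne_zero ENNReal.ofNat_ne_top, one_mul]

theorem IsCantorMeasure.measure_piece_ne_top (hν : IsCantorMeasure ν) (n : ℕ) (k : ℤ) :
    ν (piece n k) ≠ ∞ := by
  simp [hν.measure_piece]

/-- Every point lies in pieces of arbitrarily fine scale, whose measures 2⁻ⁿ tend to zero. -/
theorem IsCantorMeasure.nullSingletonClass (hν : IsCantorMeasure ν) : NullSingletonClass ν where
  measure_singleton x := by
    obtain ⟨n, k, hx⟩ := exists_mem_piece x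
    have h : ∀ m : ℕ, ν {x} ≤ (2⁻¹ : ℝ≥0∞) ^ (m + n) := fun m => by
      obtain ⟨l, hl⟩ := exists_mem_piece_add hx m
      rw [← ENNReal.inv_pow, add_comm, ← hν.measure_piece (n + m) l]
      exact measure_mono (Set.singleton_subset_iff.2 hl)
    have ht : Tendsto (fun m : ℕ => (2⁻¹ : ℝ≥0∞) ^ (m + n)) atTop (𝓝 0) :=
      (tendsto_add_atTop_iff_nat n).2
        (ENNReal.tendsto_pow_atTop_nhds_zero_of_lt_one (by norm_num))
    exact le_antisymm (ge_of_tendsto' ht h) zero_le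

theorem ae_eq_of_diff_singleton_eq [NullSingletonClass ν] {A B : Set filledCantor}
    {x : filledCantor} (h : A \ {x} = B \ {x}) : A =ᵐ[ν] B := by
  have h1 : ∀ A : Set filledCantor, (A \ {x} : Set filledCantor) =ᵐ[ν] A := fun A =>
    sdiff_null_ae_eq_self (measure_singleton x)
  exact (h1 A).symm.trans (h ▸ h1 B)

/-- Both measures agree on pieces and have no atoms, so `piece_inter_induction` makes them agree on
a generating π-system inside each piece, and the pieces cover R. -/
theorem IsCantorMeasure.eq (hν : IsCantorMeasure ν) {ν' : Measure filledCantor}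
    (hν' : IsCantorMeasure ν') : ν = ν' := by
  have := hν.nullSingletonClass
  have := hν'.nullSingletonClass
  refine Measure.ext_of_iUnion_eq_univ iUnion_piece fun ⟨n, k⟩ => ?_
  have hpiece : ∀ n k, ν (piece n k) = ν' (piece n k) := fun n k => by
    rw [hν.measure_piece, hν'.measure_piece]
  have : IsFiniteMeasure (ν.restrict (piece n k)) :=
    ⟨by rw [Measure.restrict_apply_univ]; exact (hν.measure_piece_ne_top n k).lt_top⟩
  refine ext_of_generate_finite triadicRays generateFrom_triadicRays isPiSystem_triadicRays
    (fun E hE => ?_) (by simp [hpiece])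
  rw [Measure.restrict_apply (measurableSet_triadicRays hE),
    Measure.restrict_apply (measurableSet_triadicRays hE), Set.inter_comm]
  refine piece_inter_induction (Φ := fun E => ν E = ν' E) (by simp) hpiece ?_ ?_ n k hE
  · intro A B _ hB hd h1 h2
    rw [measure_union hd hB, measure_union hd hB, h1, h2]
  · intro A B x h h1
    rw [← measure_congr (ae_eq_of_diff_singleton_eq (ν := ν) h),
      ← measure_congr (ae_eq_of_diff_singleton_eq (ν := ν') h), h1]

/-! ### The multiscale family in `L²(R, ν)` -/

/-- An integrable function whose integral over every generating ray vanishes is null. -/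
theorem ae_eq_zero_of_integral_triadicRays {ρ : Measure filledCantor}
    {f : filledCantor → ℂ} (hf : Integrable f ρ) (h0 : ∫ x, f x ∂ρ = 0)
    (h : ∀ E ∈ triadicRays, ∫ x in E, f x ∂ρ = 0) : f =ᵐ[ρ] 0 := by
  have hall : ∀ E, MeasurableSet E → ∫ x in E, f x ∂ρ = 0 := by
    intro E hE
    induction E, hE using MeasurableSpace.induction_on_inter generateFrom_triadicRays
      isPiSystem_triadicRays with
    | empty => simp
    | basic E hE => exact h E hE
    | compl E hE ih =>
      have := integral_add_compl hE hf
      rwa [ih, h0, zero_add] at this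
    | iUnion E hd hE ih =>
      have := hasSum_integral_iUnion hE hd hf.integrableOn
      simp only [ih] at this
      exact this.unique hasSum_zero
  exact hf.ae_eq_zero_of_forall_setIntegral_eq_zero fun E hE _ => hall E hE

theorem IsCantorMeasure.eq_zero_of_integral_piece (hν : IsCantorMeasure ν) (f : Lp ℂ 2 ν)
    (h : ∀ n k, ∫ x in piece n k, f x ∂ν = 0) : f = 0 := by
  have := hν.nullSingletonClass
  have hint : ∀ n k, IntegrableOn f (piece n k) ν := fun n k =>
    integrableOn_Lp_of_measure_ne_top f one_le_two (hν.measure_piece_ne_top n k)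
  rw [Lp.eq_zero_iff_ae_eq_zero]
  have hall : ∀ᵐ x ∂ν.restrict (⋃ i : ℕ × ℤ, piece i.1 i.2), f x = 0 := by
    rw [ae_restrict_iUnion_iff]
    rintro ⟨n, k⟩
    refine ae_eq_zero_of_integral_triadicRays (hint n k) (h n k) fun E hE => ?_
    rw [Measure.restrict_restrict (measurableSet_triadicRays hE), Set.inter_comm]
    -- Integrability is carried along with the vanishing integral because additivity over disjoint
    -- unions needs it.
    refine (piece_inter_induction (Φ := fun E => IntegrableOn f E ν ∧ ∫ x in E, f x ∂ν = 0)
      (by simp) (fun n k => ⟨hint n k, h n k⟩) ?_ ?_ n k hE).2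
    · rintro A B - hB hd ⟨h1, h2⟩ ⟨h3, h4⟩
      exact ⟨h1.union h3, by rw [setIntegral_union hd hB h1 h3, h2, h4, add_zero]⟩
    · rintro A B x hAB ⟨h1, h2⟩
      have hae : A =ᵐ[ν] B := ae_eq_of_diff_singleton_eq hAB
      exact ⟨h1.congr_set_ae hae.symm, by rw [← setIntegral_congr_set hae, h2]⟩
  rwa [iUnion_piece, Measure.restrict_univ] at hall

/-- The normalized indicator functions of the pieces of `R`. -/
def pieceVec (hν : IsCantorMeasure ν) (n : ℕ) (k : ℤ) : Lp ℂ 2 ν :=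
  indicatorConstLp 2 (measurableSet_piece n k) (hν.measure_piece_ne_top n k)
    (((Real.sqrt 2 : ℝ) : ℂ) ^ n)

theorem pieceVec_coeFn (hν : IsCantorMeasure ν) (n : ℕ) (k : ℤ) :
    pieceVec hν n k =ᵐ[ν] (piece n k).indicator fun _ => ((Real.sqrt 2 : ℝ) : ℂ) ^ n :=
  indicatorConstLp_coeFn

theorem indicator_pow_succ {X : Type*} (A : Set X) (c : ℂ) (n : ℕ) (x : X) :
    A.indicator (fun _ => c ^ (n + 1)) x = c * A.indicator (fun _ => c ^ n) x := by
  by_cases h : x ∈ A <;> simp [h, pow_succ']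

theorem ofReal_sqrt_two_sq : ((Real.sqrt 2 : ℝ) : ℂ) ^ 2 = 2 := by
  rw [← Complex.ofReal_pow, Real.sq_sqrt (by norm_num)]
  simp

/-- Neighbouring pieces of one scale can share an endpoint, but nothing more. -/
theorem IsCantorMeasure.measure_piece_inter (hν : IsCantorMeasure ν) (n : ℕ) {k l : ℤ}
    (h : k ≠ l) : ν (piece n k ∩ piece n l) = 0 := by
  wlog hkl : k < l generalizing k l
  · rw [Set.inter_comm]
    exact this h.symm (lt_of_le_of_ne (not_lt.1 hkl) h.symm)
  have := hν.nullSingletonClass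
  have hkl' : (k : ℝ) + 1 ≤ l := by exact_mod_cast hkl
  refine Set.Subsingleton.measure_zero (fun x hx y hy => ?_) ν
  have e : ∀ z ∈ piece n k ∩ piece n l, (3 : ℝ) ^ n * z = l := fun z hz =>
    le_antisymm ((le_of_mem_piece hz.1).2.trans hkl') (le_of_mem_piece hz.2).1
  exact Subtype.ext (mul_left_cancel₀ (by positivity) ((e x hx).trans (e y hy).symm))

theorem isCantorScaling_pieceVec (hν : IsCantorMeasure ν) : IsCantorScaling (pieceVec hν) where
  orthonormal n := by
    rw [orthonormal_iff_ite]
    intro k l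
    rw [pieceVec, pieceVec, L2.inner_indicatorConstLp_indicatorConstLp _ _
      (hν.measure_piece_ne_top n k) (hν.measure_piece_ne_top n l)]
    split_ifs with h
    · subst h
      rw [Set.inter_self, measureReal_def, hν.measure_piece, RCLike.inner_apply, map_pow,
        Complex.conj_ofReal, ← pow_add, ← two_mul, pow_mul, ofReal_sqrt_two_sq]
      simp
    · rw [measureReal_def, hν.measure_piece_inter n h]
      simp
  refine_eq n k := by
    apply Lp.ext
    filter_upwards [pieceVec_coeFn hν n k, pieceVec_coeFn hν (n + 1) (3 * k),
      pieceVec_coeFn hν (n + 1) (3 * k + 2),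
      Lp.coeFn_smul ((Real.sqrt 2 : ℝ) : ℂ)⁻¹
        (pieceVec hν (n + 1) (3 * k) + pieceVec hν (n + 1) (3 * k + 2)),
      Lp.coeFn_add (pieceVec hν (n + 1) (3 * k)) (pieceVec hν (n + 1) (3 * k + 2))]
      with x h1 h2 h3 h4 h5
    rw [h4, Pi.smul_apply, h5, Pi.add_apply, h1, h2, h3, piece_eq_union,
      Set.indicator_union_of_disjoint (disjoint_piece n k), smul_eq_mul]
    rw [indicator_pow_succ, indicator_pow_succ, ← mul_add, inv_mul_cancel_left₀ sqrt_two_ne_zero]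

/-- A function orthogonal to all these vectors has zero integral over every piece, hence vanishes.
-/
theorem pieceVec_total (hν : IsCantorMeasure ν) :
    (Submodule.span ℂ (Set.range fun i : ℕ × ℤ => pieceVec hν i.1 i.2)).topologicalClosure = ⊤ := by
  rw [Submodule.topologicalClosure_eq_top_iff, Submodule.eq_bot_iff]
  intro f hf
  refine hν.eq_zero_of_integral_piece f fun n k => ?_
  have h := (Submodule.mem_orthogonal _ f).1 hf _ (Submodule.subset_span ⟨(n, k), rfl⟩)
  simp only [pieceVec] at h
  rw [L2.inner_indicatorConstLp_eq_inner_setIntegral ℂ, RCLike.inner_apply] at h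
  simpa using h

theorem dilation_pieceVec (hν : IsCantorMeasure ν) (n : ℕ) (k : ℤ) :
    dilation hν (pieceVec hν (n + 1) k) = pieceVec hν n k := by
  apply Lp.ext
  filter_upwards [dilation_apply hν (pieceVec hν (n + 1) k), pieceVec_coeFn hν n k,
    hν.ae_shrink (pieceVec_coeFn hν (n + 1) k)] with x h1 h2 h3
  rw [h1, h2, h3]
  rw [indicator_pow_succ, inv_mul_cancel_left₀ sqrt_two_ne_zero]
  have h : x ∈ shrink ⁻¹' piece (n + 1) k ↔ x ∈ piece n k := by rw [shrink_preimage_piece]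
  by_cases hx : x ∈ piece n k
  · rw [Set.indicator_of_mem hx,
      Set.indicator_of_mem (show shrink x ∈ piece (n + 1) k from h.2 hx)]
  · rw [Set.indicator_of_notMem hx,
      Set.indicator_of_notMem (show shrink x ∉ piece (n + 1) k from mt h.1 hx)]

theorem translation_pieceVec (hν : IsCantorMeasure ν) (j : ℤ) (n : ℕ) (k : ℤ) :
    translation hν j (pieceVec hν n k) = pieceVec hν n (k + 3 ^ n * j) := by
  apply Lp.ext
  filter_upwards [translation_apply hν j (pieceVec hν n k), pieceVec_coeFn hν n (k + 3 ^ n * j),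
    (hν.measurePreserving_translateBy (-j)).quasiMeasurePreserving.ae (pieceVec_coeFn hν n k)]
    with x h1 h2 h3
  rw [h1, h2, h3]
  have h : x ∈ translateBy (-j) ⁻¹' piece n k ↔ x ∈ piece n (k + 3 ^ n * j) := by
    rw [translateBy_preimage_piece, mul_neg, sub_neg_eq_add]
  by_cases hx : x ∈ piece n (k + 3 ^ n * j)
  · rw [Set.indicator_of_mem hx,
      Set.indicator_of_mem (show translateBy (-j) x ∈ piece n k from h.2 hx)]
  · rw [Set.indicator_of_notMem hx,
      Set.indicator_of_notMem (show translateBy (-j) x ∉ piece n k from mt h.1 hx)]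

theorem pieceVec_zero_zero (hν : IsCantorMeasure ν) :
    pieceVec hν 0 0 = indicatorConstLp 2 measurableSet_cantorPart hν.cantor_ne_top (1 : ℂ) := by
  apply Lp.ext
  filter_upwards [pieceVec_coeFn hν 0 0, indicatorConstLp_coeFn (p := 2) (μ := ν)
    (hs := measurableSet_cantorPart) (hμs := hν.cantor_ne_top) (c := (1 : ℂ))] with x h1 h2
  rw [h1, h2, piece_zero_zero, pow_zero]

end Measure

/-! ### Haar measure on the circle and the filter -/

instance : circleHaar.IsHaarMeasure := Measure.isHaarMeasure_haarMeasure _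

instance : IsProbabilityMeasure circleHaar :=
  ⟨Measure.haarMeasure_self (K₀ := (⊤ : TopologicalSpace.PositiveCompacts Circle))⟩

theorem circle_exp_ne_one {t : ℝ} (h0 : 0 < t) (h1 : t < 2 * Real.pi) : Circle.exp t ≠ 1 := by
  rw [Ne, Circle.exp_eq_one]
  rintro ⟨m, hm⟩
  have hpi := Real.two_pi_pos
  rw [hm] at h0 h1
  have h2 : (0 : ℝ) < m := pos_of_mul_pos_left h0 hpi.le
  have h3 : (m : ℝ) < 1 := lt_of_mul_lt_mul_right (by linarith) hpi.le
  have h4 : (0 : ℤ) < m := by exact_mod_cast h2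
  have h5 : m < (1 : ℤ) := by exact_mod_cast h3
  omega

instance : Nontrivial Circle :=
  ⟨Circle.exp 1, 1, circle_exp_ne_one one_pos (by linarith [Real.pi_gt_three])⟩

theorem circle_exists_pow_eq {n : ℕ} (hn : n ≠ 0) (z : Circle) :
    Circle.exp (Complex.arg z / n) ^ n = z := by
  rw [← Circle.exp_nsmul, nsmul_eq_mul, mul_div_cancel₀ _ (Nat.cast_ne_zero.2 hn), Circle.exp_arg]

/-- A continuous surjective endomorphism of a compact group preserves its normalized Haar measure.
-/
theorem measurePreserving_circle_pow {n : ℕ} (hn : n ≠ 0) :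
    MeasurePreserving (fun z : Circle => z ^ n) circleHaar circleHaar :=
  (powMonoidHom n).measurePreserving (continuous_pow n)
    (fun z => ⟨_, circle_exists_pow_eq hn z⟩) rfl

/-- A function on the circle that is multiplied by a constant other than `1` under some rotation
has integral zero. -/
theorem integral_eq_zero_of_rotate {f : Circle → ℂ} (w : Circle) {c : ℂ} (hc : c ≠ 1)
    (h : ∀ z, f (w * z) = c * f z) : ∫ z, f z ∂circleHaar = 0 := by
  have h1 := integral_mul_left_eq_self (μ := circleHaar) f w
  simp only [h, integral_const_mul] at h1
  have h2 : (c - 1) * ∫ z, f z ∂circleHaar = 0 := by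
    rw [sub_mul, h1, one_mul, sub_self]
  exact (mul_eq_zero.1 h2).resolve_left (sub_ne_zero.2 hc)

theorem integral_circle_zpow {k : ℤ} (hk : k ≠ 0) : ∫ z : Circle, (z : ℂ) ^ k ∂circleHaar = 0 := by
  wlog hpos : 0 < k generalizing k
  · have h := this (k := -k) (neg_ne_zero.2 hk) (by omega)
    have h2 : ∀ z : Circle, (z : ℂ) ^ k = starRingEnd ℂ ((z : ℂ) ^ (-k)) := fun z => by
      rw [map_zpow₀, ← Circle.coe_inv_eq_conj, Circle.coe_inv, inv_zpow', neg_neg]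
    simp only [h2]
    rw [integral_conj, h, map_zero]
  have hk' : (1 : ℝ) ≤ k := by exact_mod_cast hpos
  -- Rotation by the angle π/k multiplies zᵏ by exp(iπ), which is not 1.
  have hne : Circle.exp (Real.pi / k) ^ k ≠ 1 := by
    rw [← Circle.exp_zsmul, zsmul_eq_mul, mul_div_cancel₀ _ (by positivity)]
    exact circle_exp_ne_one Real.pi_pos (by linarith [Real.pi_pos])
  refine integral_eq_zero_of_rotate (Circle.exp (Real.pi / k))
    (c := ((Circle.exp (Real.pi / k) ^ k : Circle) : ℂ)) ?_ fun z => ?_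
  · exact fun h => hne (Circle.coe_injective (h.trans Circle.coe_one.symm))
  · rw [Circle.coe_mul, mul_zpow, Circle.coe_zpow]

theorem continuous_cantorFilter : Continuous cantorFilter := by
  unfold cantorFilter
  fun_prop

/-- The only zeros are ±i. This is what permits division by m, both in `charVec` and in the absolute
continuity of the shift. -/
theorem ae_cantorFilter_ne_zero : ∀ᵐ z ∂circleHaar, cantorFilter z ≠ 0 := by
  have hfin : ((fun z : Circle => (z : ℂ)) ⁻¹' {Complex.I, -Complex.I}).Finite :=
    (Set.toFinite _).preimage Circle.coe_injective.injOn
  refine measure_mono_null (fun z hz => ?_) (hfin.measure_zero circleHaar)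
  have hz' : cantorFilter z = 0 := by simpa using hz
  have h : 1 + (z : ℂ) ^ 2 = 0 :=
    (mul_eq_zero.1 hz').resolve_left (inv_ne_zero sqrt_two_ne_zero)
  have h2 : ((z : ℂ) - Complex.I) * (z + Complex.I) = 0 := by
    linear_combination h - Complex.I_sq
  rcases mul_eq_zero.1 h2 with h3 | h3
  · exact Or.inl (sub_eq_zero.1 h3)
  · exact Or.inr (eq_neg_of_add_eq_zero_left h3)

/-- Of the frequencies 0, 2, -2 only 0 is divisible by 3, so averaging over cube roots leaves the
constant 1. -/
theorem normSq_cantorFilter (z : Circle) :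
    ((‖cantorFilter z‖ ^ 2 : ℝ) : ℂ) = 1 + 2⁻¹ * ((z : ℂ) ^ 2 + (z : ℂ) ^ (-2 : ℤ)) := by
  have hz : (z : ℂ) ≠ 0 := z.coe_ne_zero
  rw [Complex.ofReal_pow, ← Complex.mul_conj', cantorFilter, map_mul, map_inv₀, Complex.conj_ofReal,
    map_add, map_one, map_pow, ← Circle.coe_inv_eq_conj, Circle.coe_inv]
  have h : ((Real.sqrt 2 : ℝ) : ℂ)⁻¹ * ((Real.sqrt 2 : ℝ) : ℂ)⁻¹ = 2⁻¹ := by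
    rw [← mul_inv, ← sq, ofReal_sqrt_two_sq]
  rw [zpow_neg]
  calc _ = (((Real.sqrt 2 : ℝ) : ℂ)⁻¹ * ((Real.sqrt 2 : ℝ) : ℂ)⁻¹) *
        ((1 + (z : ℂ) ^ 2) * (1 + (z : ℂ)⁻¹ ^ 2)) := by ring
    _ = _ := by
      rw [h]
      norm_cast
      push_cast
      field_simp
      ring

theorem continuous_circle_coe_zpow (k : ℤ) : Continuous fun z : Circle => (z : ℂ) ^ k := by
  have h : Continuous fun z : Circle => (z : ℂ) := by fun_prop
  exact h.zpow₀ k fun z => Or.inl z.coe_ne_zero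

/-- Rotation by a primitive cube root of unity w fixes F(z³) and multiplies zᵏ by wᵏ ≠ 1. -/
theorem integral_cube_mul_zpow (F : Circle → ℂ) {k : ℤ} (hk : ¬ (3 : ℤ) ∣ k) :
    ∫ z : Circle, F (z ^ 3) * (z : ℂ) ^ k ∂circleHaar = 0 := by
  set w : Circle := Circle.exp (2 * Real.pi / 3)
  have hw3 : w ^ 3 = 1 := by
    rw [← Circle.exp_nsmul, nsmul_eq_mul]
    push_cast
    rw [mul_div_cancel₀ _ (by norm_num), Circle.exp_two_pi]
  have hpi := Real.pi_pos
  have hw1 : w ≠ 1 := circle_exp_ne_one (by positivity) (by linarith)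
  have hord : orderOf w = 3 := by
    have := Fact.mk Nat.prime_three
    exact orderOf_eq_prime hw3 hw1
  refine integral_eq_zero_of_rotate w (c := ((w ^ k : Circle) : ℂ)) ?_ fun z => ?_
  · intro h
    have h1 : w ^ k = 1 := Circle.coe_injective (h.trans Circle.coe_one.symm)
    rw [← orderOf_dvd_iff_zpow_eq_one, hord] at h1
    exact hk (by exact_mod_cast h1)
  · rw [mul_pow, hw3, one_mul, Circle.coe_mul, mul_zpow, Circle.coe_zpow]
    ring

/-- The filter `m` preserves Haar measure in the mean over the fibres of `z ↦ z³`. -/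
theorem integral_cube_mul_normSq {F : Circle → ℂ} (hF : Continuous F) :
    ∫ z, F (z ^ 3) * ((‖cantorFilter z‖ ^ 2 : ℝ) : ℂ) ∂circleHaar = ∫ z, F z ∂circleHaar := by
  have hc : ∀ k : ℤ, Continuous fun z : Circle => F (z ^ 3) * (z : ℂ) ^ k := fun k =>
    (hF.comp (continuous_pow 3)).mul (continuous_circle_coe_zpow k)
  have hi : ∀ k : ℤ, Integrable (fun z : Circle => F (z ^ 3) * (z : ℂ) ^ k) circleHaar := fun k =>
    (hc k).integrable_of_hasCompactSupport (HasCompactSupport.of_compactSpace _)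
  have h : ∀ z : Circle, F (z ^ 3) * ((‖cantorFilter z‖ ^ 2 : ℝ) : ℂ) =
      F (z ^ 3) * (z : ℂ) ^ (0 : ℤ) + 2⁻¹ * (F (z ^ 3) * (z : ℂ) ^ (2 : ℤ) +
        F (z ^ 3) * (z : ℂ) ^ (-2 : ℤ)) := fun z => by
    rw [normSq_cantorFilter, zpow_zero, zpow_ofNat]
    ring
  have hs : Integrable (fun z : Circle => F (z ^ 3) * (z : ℂ) ^ (2 : ℤ) +
      F (z ^ 3) * (z : ℂ) ^ (-2 : ℤ)) circleHaar := (hi 2).add (hi (-2))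
  simp only [h]
  rw [integral_add (hi 0) (hs.const_mul _), integral_const_mul,
    integral_add (hi 2) (hi (-2)), integral_cube_mul_zpow F (k := 2) (by norm_num),
    integral_cube_mul_zpow F (k := -2) (by norm_num)]
  simp only [zpow_zero, mul_one, add_zero, mul_zero]
  have hm := measurePreserving_circle_pow (n := 3) (by norm_num)
  conv_rhs => rw [← hm.map_eq]
  rw [integral_map hm.measurable.aemeasurable hF.aestronglyMeasurable]

/-- The products `∏_{j<n} m(z^{3^j})`. -/
def filterProd (n : ℕ) (z : Circle) : ℂ := ∏ j ∈ Finset.range n, cantorFilter (z ^ 3 ^ j)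

theorem continuous_filterProd (n : ℕ) : Continuous (filterProd n) :=
  continuous_finsetProd _ fun j _ => continuous_cantorFilter.comp (continuous_pow (3 ^ j))

theorem filterProd_succ (n : ℕ) (z : Circle) :
    filterProd (n + 1) z = filterProd n z * cantorFilter (z ^ 3 ^ n) :=
  Finset.prod_range_succ _ _

theorem filterProd_succ' (n : ℕ) (z : Circle) :
    filterProd (n + 1) z = filterProd n (z ^ 3) * cantorFilter z := by
  have h : ∀ j : ℕ, z ^ 3 ^ (j + 1) = (z ^ 3) ^ 3 ^ j := fun j => by rw [pow_succ' 3 j, pow_mul]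
  simp only [filterProd]
  rw [Finset.prod_range_succ', pow_zero, pow_one]
  simp only [h]

theorem ae_filterProd_ne_zero (n : ℕ) : ∀ᵐ z ∂circleHaar, filterProd n z ≠ 0 := by
  have h : ∀ᵐ z ∂circleHaar, ∀ j : ℕ, cantorFilter (z ^ 3 ^ j) ≠ 0 := ae_all_iff.2 fun j =>
    (measurePreserving_circle_pow (n := 3 ^ j) (by positivity)).quasiMeasurePreserving.ae
      (p := fun z => cantorFilter z ≠ 0) ae_cantorFilter_ne_zero
  filter_upwards [h] with z hz
  exact Finset.prod_ne_zero_iff.2 fun j _ => hz j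

/-- The density `∏_{j<n} |m(z^{3^j})|²`. -/
def density (n : ℕ) (z : Circle) : ℝ := ‖filterProd n z‖ ^ 2

theorem density_eq (n : ℕ) (z : Circle) :
    density n z = ∏ j ∈ Finset.range n, ‖cantorFilter (z ^ 3 ^ j)‖ ^ 2 := by
  rw [density, filterProd, norm_prod, Finset.prod_pow]

theorem continuous_density (n : ℕ) : Continuous (density n) :=
  (continuous_filterProd n).norm.pow 2

theorem density_nonneg (n : ℕ) (z : Circle) : 0 ≤ density n z := sq_nonneg _

theorem density_succ (n : ℕ) (z : Circle) :
    density (n + 1) z = density n z * ‖cantorFilter (z ^ 3 ^ n)‖ ^ 2 := by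
  rw [density, filterProd_succ, norm_mul, mul_pow, density]

theorem density_succ' (n : ℕ) (z : Circle) :
    density (n + 1) z = density n (z ^ 3) * ‖cantorFilter z‖ ^ 2 := by
  rw [density, filterProd_succ', norm_mul, mul_pow, density]

/-- The consistency condition for the prescribed marginals: the measure of level n + d maps to that
of level n under z ↦ z^{3^d}. -/
theorem integral_pow_mul_density {F : Circle → ℂ} (hF : Continuous F) (n d : ℕ) :
    ∫ z, F (z ^ 3 ^ d) * (density (n + d) z : ℂ) ∂circleHaar =
      ∫ z, F z * (density n z : ℂ) ∂circleHaar := by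
  induction d with
  | zero => simp
  | succ d ih =>
    rw [← ih]
    have hc : Continuous fun z : Circle => F (z ^ 3 ^ d) * (density (n + d) z : ℂ) :=
      (hF.comp (continuous_pow _)).mul (Complex.continuous_ofReal.comp (continuous_density _))
    rw [← integral_cube_mul_normSq hc]
    congr 1
    ext1 z
    rw [← add_assoc, density_succ', ← pow_mul, ← pow_succ']
    push_cast
    ring

/-! ### The solenoid -/

theorem isClosed_solenoid : IsClosed {ζ : ℕ → Circle | ∀ n, ζ (n + 1) ^ 3 = ζ n} := by
  rw [Set.ofPred_forall]
  exact isClosed_iInter fun n => isClosed_eq (by fun_prop) (by fun_prop)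

instance : CompactSpace Solenoid := isCompact_iff_compactSpace.1 isClosed_solenoid.isCompact

instance : TopologicalSpace.MetrizableSpace Solenoid :=
  Topology.IsEmbedding.subtypeVal.metrizableSpace

theorem continuous_proj (n : ℕ) : Continuous (proj n) :=
  (continuous_apply n).comp continuous_subtype_val

theorem measurable_proj (n : ℕ) : Measurable (proj n) := (continuous_proj n).measurable

theorem continuous_shift : Continuous shift := by
  refine Continuous.subtype_mk (continuous_pi fun n => ?_) _
  cases n with
  | zero => exact (continuous_proj 0).pow 3
  | succ n => exact continuous_proj n

theorem proj_succ_pow (n : ℕ) (ζ : Solenoid) : proj (n + 1) ζ ^ 3 = proj n ζ := ζ.2 n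

theorem proj_succ_shift (n : ℕ) (ζ : Solenoid) : proj (n + 1) (shift ζ) = proj n ζ := rfl

theorem proj_add_pow (n d : ℕ) (ζ : Solenoid) : proj (n + d) ζ ^ 3 ^ d = proj n ζ := by
  induction d with
  | zero => simp
  | succ d ih => rw [pow_succ' 3 d, pow_mul, ← add_assoc, proj_succ_pow, ih]

theorem proj_pow_eq_zero (n : ℕ) (ζ : Solenoid) : proj n ζ ^ 3 ^ n = proj 0 ζ := by
  have := proj_add_pow 0 n ζ
  rwa [zero_add] at this

/-! ### Existence of the measure on the solenoid -/

/-- A measurable branch of the cube root on the circle. -/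
def cubeRoot (z : Circle) : Circle := Circle.exp (Complex.arg z / (3 : ℕ))

theorem cubeRoot_pow (z : Circle) : cubeRoot z ^ 3 = z := circle_exists_pow_eq (by norm_num) z

theorem measurable_cubeRoot : Measurable cubeRoot := by
  have h : Measurable fun z : Circle => (z : ℂ) :=
    (by fun_prop : Continuous fun z : Circle => (z : ℂ)).measurable
  exact Circle.exp.continuous.measurable.comp ((Complex.measurable_arg.comp h).div_const _)

/-- A measurable section of the projection `πₙ`. -/
def solenoidSection (n : ℕ) (z : Circle) : Solenoid :=
  -- Subtraction is truncated, so this takes powers of z at levels i ≤ n and iterated cube roots at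
  -- levels i > n.
  ⟨fun i => (cubeRoot^[i - n] z) ^ 3 ^ (n - i), fun i => by
    beta_reduce
    rcases lt_or_ge i n with h | h
    · rw [Nat.sub_eq_zero_of_le h, Nat.sub_eq_zero_of_le h.le, ← pow_mul, ← pow_succ,
        show n - (i + 1) + 1 = n - i by omega]
    · rw [Nat.sub_eq_zero_of_le h, Nat.sub_eq_zero_of_le (by omega : n ≤ i + 1),
        Nat.sub_add_comm h, Function.iterate_succ_apply', pow_zero, pow_one, pow_one, cubeRoot_pow]⟩

theorem measurable_solenoidSection (n : ℕ) : Measurable (solenoidSection n) := by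
  refine Measurable.subtype_mk (measurable_pi_lambda _ fun i => ?_)
  exact (continuous_pow _).measurable.comp (measurable_cubeRoot.iterate _)

theorem proj_solenoidSection {n i : ℕ} (h : i ≤ n) (z : Circle) :
    proj i (solenoidSection n z) = z ^ 3 ^ (n - i) := by
  change (cubeRoot^[i - n] z) ^ 3 ^ (n - i) = _
  rw [Nat.sub_eq_zero_of_le h]
  rfl

/-- The measure `∏_{j<n} |m(z^{3^j})|² dz` on the circle. -/
def densityMeasure (n : ℕ) : Measure Circle :=
  circleHaar.withDensity fun z => ENNReal.ofReal (density n z)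

theorem measurable_ofReal_density (n : ℕ) : Measurable fun z => ENNReal.ofReal (density n z) :=
  (continuous_density n).measurable.ennreal_ofReal

theorem integral_densityMeasure (n : ℕ) (g : Circle → ℂ) :
    ∫ z, g z ∂densityMeasure n = ∫ z, g z * (density n z : ℂ) ∂circleHaar := by
  rw [densityMeasure, integral_withDensity_eq_integral_toReal_smul (measurable_ofReal_density n)
    (Eventually.of_forall fun z => ENNReal.ofReal_lt_top)]
  congr 1
  ext1 z
  rw [ENNReal.toReal_ofReal (density_nonneg n z), Complex.real_smul, mul_comm]

instance (n : ℕ) : IsFiniteMeasure (densityMeasure n) := by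
  have h : Integrable (density n) circleHaar :=
    (continuous_density n).integrable_of_hasCompactSupport (HasCompactSupport.of_compactSpace _)
  exact isFiniteMeasure_withDensity_ofReal h.2

instance (n : ℕ) : IsProbabilityMeasure (densityMeasure n) := by
  have h := integral_pow_mul_density (F := fun _ => 1) continuous_const 0 n
  have h2 := integral_densityMeasure n (fun _ => 1)
  rw [zero_add] at h
  rw [h] at h2
  simp only [density, filterProd, Finset.range_zero, Finset.prod_empty, norm_one, one_pow,
    Complex.ofReal_one, mul_one, integral_const, probReal_univ, one_smul] at h2
  refine ⟨?_⟩
  have h3 : (densityMeasure n).real Set.univ = 1 := by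
    rw [Complex.real_smul, mul_one] at h2
    exact_mod_cast h2
  rw [measureReal_def] at h3
  exact (ENNReal.toReal_eq_one_iff _).1 h3

/-- Lifting the level-n measure by a section of πₙ gives a probability measure with the right
marginals up to level n. The probability measures on the compact solenoid form a compact space, so
an ultrafilter limit exists. -/
theorem exists_isSolenoidMeasure : ∃ τ : Measure Solenoid, IsSolenoidMeasure τ := by
  let ρ : ℕ → ProbabilityMeasure Solenoid := fun n =>
    ⟨(densityMeasure n).map (solenoidSection n),
      Measure.isProbabilityMeasure_map (measurable_solenoidSection n).aemeasurable⟩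
  have hρ : ∀ (k n : ℕ) (f : C(Circle, ℂ)), k ≤ n →
      ∫ ζ, f (proj k ζ) ∂(ρ n : Measure Solenoid) = ∫ z, f z * (density k z : ℂ) ∂circleHaar := by
    intro k n f hkn
    change ∫ ζ, f (proj k ζ) ∂(densityMeasure n).map (solenoidSection n) = _
    have hm : Continuous fun ζ => f (proj k ζ) := f.continuous.comp (continuous_proj k)
    rw [integral_map (measurable_solenoidSection n).aemeasurable hm.aestronglyMeasurable,
      integral_densityMeasure]
    simp only [proj_solenoidSection hkn]
    obtain ⟨d, rfl⟩ := Nat.exists_eq_add_of_le hkn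
    rw [Nat.add_sub_cancel_left]
    exact integral_pow_mul_density f.continuous k d
  let U : Ultrafilter (ProbabilityMeasure Solenoid) := (hyperfilter ℕ).map ρ
  have hU : Tendsto ρ (hyperfilter ℕ) (𝓝 U.lim) := U.le_nhds_lim
  refine ⟨U.lim, inferInstance, fun k f => ?_⟩
  have h1 := (ProbabilityMeasure.tendsto_iff_forall_integral_rclike_tendsto ℂ).1 hU
    (BoundedContinuousFunction.mkOfCompact (f.comp ⟨proj k, continuous_proj k⟩))
  -- The ultrafilter is nonprincipal, so each fixed marginal is eventually constant along it and
  -- passes to the limit.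
  have h2 : ∀ᶠ n in (hyperfilter ℕ : Filter ℕ), k ≤ n := by
    have h := hyperfilter_le_cofinite (α := ℕ)
    rw [Nat.cofinite_eq_atTop] at h
    exact h (eventually_ge_atTop k)
  have h3 := tendsto_nhds_unique h1
    (tendsto_const_nhds.congr' (h2.mono fun n hn => (hρ k n f hn).symm))
  simp only [density_eq] at h3
  exact h3

/-! ### Characters of the solenoid and uniqueness of the measure -/

/-- The character `ζ ↦ ζₙᵏ` of the solenoid. -/
def char (i : ℕ × ℤ) : C(Solenoid, ℂ) :=
  ⟨fun ζ => (proj i.1 ζ : ℂ) ^ i.2, (continuous_circle_coe_zpow i.2).comp (continuous_proj i.1)⟩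

theorem char_apply (n : ℕ) (k : ℤ) (ζ : Solenoid) : char (n, k) ζ = (proj n ζ : ℂ) ^ k := rfl

theorem char_add (n d : ℕ) (k : ℤ) : char (n + d, 3 ^ d * k) = char (n, k) := by
  ext ζ
  rw [char_apply, char_apply, ← proj_add_pow n d, zpow_mul, Circle.coe_pow]
  norm_cast

theorem star_char (n : ℕ) (k : ℤ) : star (char (n, k)) = char (n, -k) := by
  ext ζ
  rw [ContinuousMap.star_apply, char_apply, char_apply, Complex.star_def, map_zpow₀,
    ← Circle.coe_inv_eq_conj, Circle.coe_inv, inv_zpow']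

/-- Both factors are lifted to a common level, where exponents add; so the span of the characters is
already an algebra. -/
theorem char_mul_mem (i j : ℕ × ℤ) : char i * char j ∈ Set.range char := by
  refine ⟨(i.1 + j.1, 3 ^ j.1 * i.2 + 3 ^ i.1 * j.2), ?_⟩
  rw [← char_add i.1 j.1 i.2, ← char_add j.1 i.1 j.2, add_comm j.1]
  ext ζ
  rw [ContinuousMap.mul_apply, char_apply, char_apply, char_apply, zpow_add₀ (Circle.coe_ne_zero _)]

/-- The star subalgebra of `C(S₃)` generated by the characters. -/
def charAlgebra : StarSubalgebra ℂ C(Solenoid, ℂ) where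
  toSubalgebra := Algebra.adjoin ℂ (Set.range char)
  star_mem' := by
    change Algebra.adjoin ℂ (Set.range char) ≤ star (Algebra.adjoin ℂ (Set.range char))
    refine Algebra.adjoin_le ?_
    rintro - ⟨⟨n, k⟩, rfl⟩
    exact Algebra.subset_adjoin ⟨(n, -k), (star_char n k).symm⟩

theorem charAlgebra_toSubmodule :
    Subalgebra.toSubmodule charAlgebra.toSubalgebra = Submodule.span ℂ (Set.range char) := by
  apply Algebra.adjoin_eq_span_of_subset
  refine Set.Subset.trans ?_ Submodule.subset_span
  intro x hx
  refine Submonoid.closure_induction (fun _ => id) ⟨(0, 0), ?_⟩ ?_ hx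
  · ext ζ
    simp [char_apply]
  · rintro - - - - ⟨i, rfl⟩ ⟨j, rfl⟩
    exact char_mul_mem i j

/-- Stone–Weierstrass: the coordinates ζₙ are themselves characters and separate points. -/
theorem span_char_topologicalClosure :
    (Submodule.span ℂ (Set.range char)).topologicalClosure = ⊤ := by
  rw [← charAlgebra_toSubmodule]
  refine congrArg (Subalgebra.toSubmodule <| StarSubalgebra.toSubalgebra ·)
    (ContinuousMap.starSubalgebra_topologicalClosure_eq_top_of_separatesPoints charAlgebra ?_)
  intro ζ ξ h
  have h1 : ∃ n, proj n ζ ≠ proj n ξ := by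
    by_contra! h2
    exact h (Subtype.ext (funext h2))
  obtain ⟨n, hn⟩ := h1
  refine ⟨_, ⟨char (n, 1), Algebra.subset_adjoin ⟨(n, 1), rfl⟩, rfl⟩, ?_⟩
  change (proj n ζ : ℂ) ^ (1 : ℤ) ≠ (proj n ξ : ℂ) ^ (1 : ℤ)
  rw [zpow_one, zpow_one]
  exact fun h2 => hn (Circle.coe_injective h2)

theorem integrable_continuousMap {X : Type*} [TopologicalSpace X] [CompactSpace X]
    [MeasurableSpace X] [OpensMeasurableSpace X] {ρ : Measure X} [IsFiniteMeasure ρ]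
    (f : C(X, ℂ)) : Integrable f ρ :=
  (BoundedContinuousFunction.mkOfCompact f).integrable ρ

/-- A finite measure on the solenoid is determined by its Fourier coefficients. -/
theorem measure_ext_of_integral_char {ρ ρ' : Measure Solenoid} [IsFiniteMeasure ρ]
    [IsFiniteMeasure ρ'] (h : ∀ n k, ∫ ζ, (proj (n + 1) ζ : ℂ) ^ k ∂ρ =
      ∫ ζ, (proj (n + 1) ζ : ℂ) ^ (k : ℤ) ∂ρ') : ρ = ρ' := by
  let V : Submodule ℂ C(Solenoid, ℂ) :=
    { carrier := {f | ∫ ζ, f ζ ∂ρ = ∫ ζ, f ζ ∂ρ'}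
      add_mem' := by
        intro f g (hf : _ = _) (hg : _ = _)
        change ∫ ζ, f ζ + g ζ ∂ρ = ∫ ζ, f ζ + g ζ ∂ρ'
        rw [integral_add (integrable_continuousMap f) (integrable_continuousMap g),
          integral_add (integrable_continuousMap f) (integrable_continuousMap g), hf, hg]
      zero_mem' := by
        change ∫ ζ, (0 : ℂ) ∂ρ = ∫ ζ, (0 : ℂ) ∂ρ'
        simp
      smul_mem' := by
        intro c f (hf : _ = _)
        change ∫ ζ, c * f ζ ∂ρ = ∫ ζ, c * f ζ ∂ρ'
        rw [integral_const_mul, integral_const_mul, hf] }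
  have hcont : ∀ σ : Measure Solenoid, [IsFiniteMeasure σ] →
      Continuous fun f : C(Solenoid, ℂ) => ∫ ζ, f ζ ∂σ := fun σ _ => by
    refine continuous_iff_continuousAt.2 fun f => ?_
    refine tendsto_integral_filter_of_dominated_convergence (fun _ => ‖f‖ + 1)
      (Eventually.of_forall fun g => g.continuous.aestronglyMeasurable) ?_ (integrable_const _)
      (Eventually.of_forall fun ζ => (continuous_eval_const ζ).tendsto f)
    filter_upwards [(continuous_norm.tendsto f).eventually_lt_const (lt_add_one ‖f‖)] with g hg
    exact Eventually.of_forall fun ζ => (g.norm_coe_le_norm ζ).trans hg.le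
  have hV : IsClosed (V : Set C(Solenoid, ℂ)) := isClosed_eq (hcont ρ) (hcont ρ')
  have hle : (Submodule.span ℂ (Set.range char)).topologicalClosure ≤ V := by
    refine Submodule.topologicalClosure_minimal _ (Submodule.span_le.2 ?_) hV
    rintro _ ⟨⟨n, k⟩, rfl⟩
    -- Every character lives on the next level too, so the coefficients at positive levels suffice.
    -- These are the levels at which the shift acts by π_{n+1} ∘ h = πₙ.
    rw [← char_add n 1]
    exact h n _
  rw [span_char_topologicalClosure] at hle
  refine ext_of_forall_integral_eq_of_IsFiniteMeasure fun f => ?_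
  have h1 : ∫ ζ, (f ζ : ℂ) ∂ρ = ∫ ζ, (f ζ : ℂ) ∂ρ' :=
    hle (x := ⟨fun ζ => (f ζ : ℂ), Complex.continuous_ofReal.comp f.continuous⟩) trivial
  rw [integral_complex_ofReal, integral_complex_ofReal] at h1
  exact_mod_cast h1

section Measure

variable {τ : Measure Solenoid}

theorem IsSolenoidMeasure.integral_comp_proj' (hτ : IsSolenoidMeasure τ) (n : ℕ) {f : Circle → ℂ}
    (hf : Continuous f) :
    ∫ ζ, f (proj n ζ) ∂τ = ∫ z, f z * (density n z : ℂ) ∂circleHaar := by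
  have h := hτ.integral_comp_proj n ⟨f, hf⟩
  simp only [← density_eq] at h
  exact h

theorem IsSolenoidMeasure.eq (hτ : IsSolenoidMeasure τ) {τ' : Measure Solenoid}
    (hτ' : IsSolenoidMeasure τ') : τ = τ' := by
  have := hτ.isProbabilityMeasure
  have := hτ'.isProbabilityMeasure
  refine measure_ext_of_integral_char fun n k => ?_
  rw [hτ.integral_comp_proj' (n + 1) (continuous_circle_coe_zpow k),
    hτ'.integral_comp_proj' (n + 1) (continuous_circle_coe_zpow k)]

theorem IsSolenoidMeasure.map_proj (hτ : IsSolenoidMeasure τ) (n : ℕ) :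
    τ.map (proj n) = densityMeasure n := by
  have := hτ.isProbabilityMeasure
  have := Measure.isProbabilityMeasure_map (μ := τ) (measurable_proj n).aemeasurable
  refine ext_of_forall_integral_eq_of_IsFiniteMeasure fun f => ?_
  have hf : Continuous fun z => (f z : ℂ) := Complex.continuous_ofReal.comp f.continuous
  have h := hτ.integral_comp_proj' n hf
  rw [← integral_densityMeasure, integral_complex_ofReal, integral_complex_ofReal] at h
  rw [integral_map (measurable_proj n).aemeasurable f.continuous.aestronglyMeasurable]
  exact_mod_cast h

theorem IsSolenoidMeasure.ae_proj (hτ : IsSolenoidMeasure τ) (n : ℕ) {p : Circle → Prop}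
    (h : ∀ᵐ z ∂circleHaar, p z) : ∀ᵐ ζ ∂τ, p (proj n ζ) := by
  have h1 : ∀ᵐ z ∂τ.map (proj n), p z := by
    rw [hτ.map_proj]
    exact withDensity_absolutelyContinuous _ _ h
  exact ae_of_ae_map (measurable_proj n).aemeasurable h1

/-- Tested on a character of level n + 1, the weight |m(ζ₀)|² = |m(ζₙ^{3ⁿ})|² is exactly the extra
factor that turns the density of level n into that of level n + 1. -/
theorem IsSolenoidMeasure.map_shift (hτ : IsSolenoidMeasure τ) :
    (τ.withDensity fun ζ => ENNReal.ofReal (‖cantorFilter (proj 0 ζ)‖ ^ 2)).map shift = τ := by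
  have := hτ.isProbabilityMeasure
  have hc : Continuous fun ζ => ‖cantorFilter (proj 0 ζ)‖ ^ 2 :=
    ((continuous_cantorFilter.comp (continuous_proj 0)).norm.pow 2)
  have : IsFiniteMeasure
      (τ.withDensity fun ζ => ENNReal.ofReal (‖cantorFilter (proj 0 ζ)‖ ^ 2)) :=
    isFiniteMeasure_withDensity_ofReal
      (hc.integrable_of_hasCompactSupport (HasCompactSupport.of_compactSpace _)).2
  refine measure_ext_of_integral_char fun n k => ?_
  have hk := continuous_circle_coe_zpow k
  have hk' : Continuous fun ζ => (proj (n + 1) ζ : ℂ) ^ k := hk.comp (continuous_proj (n + 1))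
  rw [integral_map continuous_shift.measurable.aemeasurable hk'.aestronglyMeasurable,
    integral_withDensity_eq_integral_toReal_smul hc.measurable.ennreal_ofReal
    (Eventually.of_forall fun z => ENNReal.ofReal_lt_top),
    hτ.integral_comp_proj' (n + 1) hk]
  have hf : Continuous fun z : Circle =>
      (z : ℂ) ^ k * ((‖cantorFilter (z ^ 3 ^ n)‖ ^ 2 : ℝ) : ℂ) :=
    hk.mul (Complex.continuous_ofReal.comp
      ((continuous_cantorFilter.comp (continuous_pow _)).norm.pow 2))
  refine Eq.trans ?_ ((hτ.integral_comp_proj' n hf).trans ?_)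
  · congr 1
    ext1 ζ
    rw [ENNReal.toReal_ofReal (sq_nonneg _), proj_pow_eq_zero, Complex.real_smul, mul_comm,
      proj_succ_shift]
  · congr 1
    ext1 z
    rw [density_succ]
    push_cast
    ring

/-- As m is nonzero almost everywhere, τ is absolutely continuous with respect to the weighted
measure whose image is τ. So f ∘ h is well defined on classes modulo τ-null sets. -/
theorem IsSolenoidMeasure.quasiMeasurePreserving_shift (hτ : IsSolenoidMeasure τ) :
    Measure.QuasiMeasurePreserving shift τ τ := by
  refine ⟨continuous_shift.measurable, ?_⟩
  have hc : Continuous fun ζ => ‖cantorFilter (proj 0 ζ)‖ ^ 2 :=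
    ((continuous_cantorFilter.comp (continuous_proj 0)).norm.pow 2)
  have h : τ ≪ τ.withDensity fun ζ => ENNReal.ofReal (‖cantorFilter (proj 0 ζ)‖ ^ 2) := by
    refine withDensity_absolutelyContinuous' hc.measurable.ennreal_ofReal.aemeasurable ?_
    filter_upwards [hτ.ae_proj 0 ae_cantorFilter_ne_zero] with ζ h1
    simpa using h1
  have h2 := h.map continuous_shift.measurable
  rwa [hτ.map_shift] at h2

/-! ### The multiscale family in `L²(S₃, τ)` -/

/-- The function `z ↦ zᵏ / ∏_{j<n} m(z^{3^j})` on the circle. -/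
def normChar (n : ℕ) (k : ℤ) (z : Circle) : ℂ := (z : ℂ) ^ k * (filterProd n z)⁻¹

theorem measurable_normChar (n : ℕ) (k : ℤ) : Measurable (normChar n k) :=
  (continuous_circle_coe_zpow k).measurable.mul (continuous_filterProd n).measurable.inv

theorem IsSolenoidMeasure.integrable_comp_proj (hτ : IsSolenoidMeasure τ) (n : ℕ) {g : Circle → ℝ}
    (hg : Measurable g) (h : Integrable (fun z => density n z * g z) circleHaar) :
    Integrable (fun ζ => g (proj n ζ)) τ := by
  have h1 : Integrable g (τ.map (proj n)) := by
    rw [hτ.map_proj, densityMeasure, integrable_withDensity_iff_integrable_smul'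
      (measurable_ofReal_density n) (Eventually.of_forall fun z => ENNReal.ofReal_lt_top)]
    simpa only [ENNReal.toReal_ofReal (density_nonneg n _), smul_eq_mul] using h
  exact (integrable_map_measure hg.aestronglyMeasurable (measurable_proj n).aemeasurable).1 h1

theorem IsSolenoidMeasure.memLp_normChar (hτ : IsSolenoidMeasure τ) (n : ℕ) (k : ℤ) :
    MemLp (fun ζ => normChar n k (proj n ζ)) 2 τ := by
  have hm : Measurable fun ζ => normChar n k (proj n ζ) :=
    (measurable_normChar n k).comp (measurable_proj n)
  rw [memLp_two_iff_integrable_sq_norm hm.aestronglyMeasurable]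
  refine hτ.integrable_comp_proj n (g := fun z => ‖normChar n k z‖ ^ 2)
    ((measurable_normChar n k).norm.pow_const 2) ?_
  refine (integrable_const (1 : ℝ)).congr ?_
  filter_upwards [ae_filterProd_ne_zero n] with z hz
  have h1 : ‖filterProd n z‖ ≠ 0 := norm_ne_zero_iff.2 hz
  rw [normChar, density, norm_mul, norm_zpow, Circle.norm_coe, one_zpow, norm_inv, one_mul, inv_pow,
    mul_inv_cancel₀ (pow_ne_zero 2 h1)]

/-- The elements `ζₙᵏ / ∏_{j<n} m(ζₙ^{3^j})` of `L²(S₃, τ)`. -/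
def charVec (hτ : IsSolenoidMeasure τ) (n : ℕ) (k : ℤ) : Lp ℂ 2 τ :=
  (hτ.memLp_normChar n k).toLp _

theorem charVec_coeFn (hτ : IsSolenoidMeasure τ) (n : ℕ) (k : ℤ) :
    charVec hτ n k =ᵐ[τ] fun ζ => normChar n k (proj n ζ) :=
  (hτ.memLp_normChar n k).coeFn_toLp

/-- The sum of the two numerators over √2 is z^{3k} m(z), and m(z) is the factor by which the
denominator at z exceeds the one at z³. -/
theorem normChar_refine (n : ℕ) (k : ℤ) {z : Circle} (hz : cantorFilter z ≠ 0) :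
    normChar n k (z ^ 3) = ((Real.sqrt 2 : ℝ) : ℂ)⁻¹ *
      (normChar (n + 1) (3 * k) z + normChar (n + 1) (3 * k + 2) z) := by
  have h0 : (z : ℂ) ≠ 0 := z.coe_ne_zero
  have h1 : ((Real.sqrt 2 : ℝ) : ℂ)⁻¹ * (normChar (n + 1) (3 * k) z + normChar (n + 1) (3 * k + 2) z)
      = (z : ℂ) ^ (3 * k) * cantorFilter z * (filterProd n (z ^ 3) * cantorFilter z)⁻¹ := by
    rw [normChar, normChar, filterProd_succ', zpow_add₀ h0, zpow_ofNat]
    generalize (filterProd n (z ^ 3) * cantorFilter z)⁻¹ = a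
    rw [cantorFilter]
    ring
  rw [h1, mul_inv, normChar, zpow_mul, Circle.coe_pow]
  field_simp

/-- The denominators cancel the density of the level-n marginal, so inner products at one scale
become those of the characters zᵏ under Haar measure. -/
theorem isCantorScaling_charVec (hτ : IsSolenoidMeasure τ) : IsCantorScaling (charVec hτ) where
  orthonormal n := by
    rw [orthonormal_iff_ite]
    intro k l
    have h1 : ⟪charVec hτ n k, charVec hτ n l⟫_ℂ =
        ∫ ζ, starRingEnd ℂ (normChar n k (proj n ζ)) * normChar n l (proj n ζ) ∂τ := by
      rw [L2.inner_def]
      refine integral_congr_ae ?_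
      filter_upwards [charVec_coeFn hτ n k, charVec_coeFn hτ n l] with ζ h1 h2
      rw [h1, h2, RCLike.inner_apply, mul_comm]
    have hm : Measurable fun z => starRingEnd ℂ (normChar n k z) * normChar n l z :=
      (Complex.continuous_conj.measurable.comp (measurable_normChar n k)).mul
        (measurable_normChar n l)
    have h2 : ∫ ζ, starRingEnd ℂ (normChar n k (proj n ζ)) * normChar n l (proj n ζ) ∂τ =
        ∫ z, starRingEnd ℂ (normChar n k z) * normChar n l z ∂densityMeasure n := by
      rw [← hτ.map_proj, integral_map (measurable_proj n).aemeasurable hm.aestronglyMeasurable]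
    have h3 : ∫ z, starRingEnd ℂ (normChar n k z) * normChar n l z * (density n z : ℂ) ∂circleHaar =
        ∫ z : Circle, (z : ℂ) ^ (l - k) ∂circleHaar := by
      refine integral_congr_ae ?_
      filter_upwards [ae_filterProd_ne_zero n] with z hz
      have h0 : (z : ℂ) ≠ 0 := z.coe_ne_zero
      have hz' : starRingEnd ℂ (filterProd n z) ≠ 0 := (map_ne_zero _).2 hz
      rw [normChar, normChar, density, Complex.ofReal_pow, ← Complex.mul_conj', map_mul, map_inv₀,
        map_zpow₀, ← Circle.coe_inv_eq_conj, Circle.coe_inv, inv_zpow', sub_eq_add_neg,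
        zpow_add₀ h0]
      field_simp
    rw [h1, h2, integral_densityMeasure, h3]
    split_ifs with h
    · subst h
      simp
    · exact integral_circle_zpow (sub_ne_zero.2 (Ne.symm h))
  refine_eq n k := by
    apply Lp.ext
    filter_upwards [charVec_coeFn hτ n k, charVec_coeFn hτ (n + 1) (3 * k),
      charVec_coeFn hτ (n + 1) (3 * k + 2),
      Lp.coeFn_smul ((Real.sqrt 2 : ℝ) : ℂ)⁻¹
        (charVec hτ (n + 1) (3 * k) + charVec hτ (n + 1) (3 * k + 2)),
      Lp.coeFn_add (charVec hτ (n + 1) (3 * k)) (charVec hτ (n + 1) (3 * k + 2)),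
      hτ.ae_proj (n + 1) ae_cantorFilter_ne_zero] with ζ h1 h2 h3 h4 h5 h6
    rw [h4, Pi.smul_apply, h5, Pi.add_apply, h1, h2, h3, ← proj_succ_pow n ζ,
      normChar_refine n k h6, smul_eq_mul]

/-- Multiplying by m(z^{3^j}) = 2^{-1/2}(1 + z^{2·3^j}) keeps the span at level n, since it only
shifts k. With j = n the denominator is cleared, so the span contains the characters. -/
theorem exists_mem_span_charVec (hτ : IsSolenoidMeasure τ) (n j : ℕ) (k : ℤ) :
    ∃ g ∈ Submodule.span ℂ (Set.range fun i : ℕ × ℤ => charVec hτ i.1 i.2),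
      g =ᵐ[τ] fun ζ => normChar n k (proj n ζ) * filterProd j (proj n ζ) := by
  induction j generalizing k with
  | zero =>
    refine ⟨charVec hτ n k, Submodule.subset_span ⟨(n, k), rfl⟩, ?_⟩
    filter_upwards [charVec_coeFn hτ n k] with ζ h
    simp [h, filterProd]
  | succ j ih =>
    obtain ⟨g₁, hg₁, h1⟩ := ih k
    obtain ⟨g₂, hg₂, h2⟩ := ih (k + 2 * 3 ^ j)
    refine ⟨((Real.sqrt 2 : ℝ) : ℂ)⁻¹ • (g₁ + g₂),
      Submodule.smul_mem _ _ (Submodule.add_mem _ hg₁ hg₂), ?_⟩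
    filter_upwards [h1, h2, Lp.coeFn_smul ((Real.sqrt 2 : ℝ) : ℂ)⁻¹ (g₁ + g₂),
      Lp.coeFn_add g₁ g₂] with ζ e1 e2 e3 e4
    rw [e3, Pi.smul_apply, e4, Pi.add_apply, e1, e2, filterProd_succ, cantorFilter, normChar,
      normChar, zpow_add₀ (Circle.coe_ne_zero _), smul_eq_mul, Circle.coe_pow]
    have h : ((proj n ζ : Circle) : ℂ) ^ (2 * 3 ^ j : ℤ) = (((proj n ζ : Circle) : ℂ) ^ 3 ^ j) ^ 2 := by
      rw [← pow_mul, mul_comm]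
      norm_cast
    rw [h]
    ring

/-- The closed span contains the characters, hence all continuous functions, which are dense in L².
-/
theorem charVec_total (hτ : IsSolenoidMeasure τ) :
    (Submodule.span ℂ (Set.range fun i : ℕ × ℤ => charVec hτ i.1 i.2)).topologicalClosure = ⊤ := by
  have := hτ.isProbabilityMeasure
  set V := Submodule.span ℂ (Set.range fun i : ℕ × ℤ => charVec hτ i.1 i.2)
  let L : C(Solenoid, ℂ) →L[ℂ] Lp ℂ 2 τ := ContinuousMap.toLp 2 τ ℂ
  have hchar : ∀ i, L (char i) ∈ V := by
    rintro ⟨n, k⟩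
    obtain ⟨g, hg, h⟩ := exists_mem_span_charVec hτ n n k
    convert hg
    apply Lp.ext
    filter_upwards [h, ContinuousMap.coeFn_toLp (p := 2) (𝕜 := ℂ) τ (char (n, k)),
      hτ.ae_proj n (ae_filterProd_ne_zero n)] with ζ h1 h2 h3
    rw [h1, h2, char_apply, normChar, inv_mul_cancel_right₀ h3]
  have hle : (Submodule.span ℂ (Set.range char)).topologicalClosure ≤
      V.topologicalClosure.comap (L : C(Solenoid, ℂ) →ₗ[ℂ] Lp ℂ 2 τ) := by
    refine Submodule.topologicalClosure_minimal _ (Submodule.span_le.2 ?_)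
      (V.isClosed_topologicalClosure.preimage L.continuous)
    rintro _ ⟨i, rfl⟩
    exact V.le_topologicalClosure (hchar i)
  rw [span_char_topologicalClosure] at hle
  have hd : DenseRange L := ContinuousMap.toLp_denseRange ℂ τ ℂ (by norm_num)
  rw [eq_top_iff]
  intro f _
  have h1 : closure (Set.range L) ⊆ V.topologicalClosure :=
    closure_minimal (by rintro _ ⟨g, rfl⟩; exact hle trivial) V.isClosed_topologicalClosure
  exact h1 (hd f)

end Measure

/-! ### Matching the operators on the two families -/

/-- Scale 0 is redundant by refinement. It has to be dropped because D is computed only on vectors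
of scale n + 1, which it sends to scale n. -/
theorem IsCantorScaling.total_succ {H : Type*} [NormedAddCommGroup H] [InnerProductSpace ℂ H]
    {u : ℕ → ℤ → H} (hu : IsCantorScaling u)
    (ht : (Submodule.span ℂ (Set.range fun i : ℕ × ℤ => u i.1 i.2)).topologicalClosure = ⊤) :
    (Submodule.span ℂ (Set.range fun i : ℕ × ℤ => u (i.1 + 1) i.2)).topologicalClosure = ⊤ := by
  rw [eq_top_iff, ← ht]
  refine Submodule.topologicalClosure_mono (Submodule.span_le.2 ?_)
  rintro _ ⟨⟨n, k⟩, rfl⟩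
  change u n k ∈ Submodule.span ℂ (Set.range fun i : ℕ × ℤ => u (i.1 + 1) i.2)
  rw [hu.refine_eq n k]
  exact Submodule.smul_mem _ _ (Submodule.add_mem _ (Submodule.subset_span ⟨(n, _), rfl⟩)
    (Submodule.subset_span ⟨(n, _), rfl⟩))

section Measure

variable {τ : Measure Solenoid}

theorem charVec_zero_zero (hτ : IsSolenoidMeasure τ) : charVec hτ 0 0 =ᵐ[τ] fun _ => (1 : ℂ) := by
  filter_upwards [charVec_coeFn hτ 0 0] with ζ h
  simp [h, normChar, filterProd]

/-- The denominator of level n + 1 at ζₙ has the additional factor m(ζₙ^{3ⁿ}) = m(ζ₀), which the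
weight cancels. -/
theorem charVec_shift (hτ : IsSolenoidMeasure τ) (n : ℕ) (k : ℤ) :
    charVec hτ n k =ᵐ[τ] fun ζ => cantorFilter (proj 0 ζ) * charVec hτ (n + 1) k (shift ζ) := by
  filter_upwards [charVec_coeFn hτ n k,
    hτ.quasiMeasurePreserving_shift.ae (charVec_coeFn hτ (n + 1) k),
    hτ.ae_proj 0 ae_cantorFilter_ne_zero] with ζ h1 h2 h3
  rw [h1, h2, proj_succ_shift, normChar, normChar, filterProd_succ, proj_pow_eq_zero, mul_inv]
  field_simp

theorem charVec_mul_zpow (hτ : IsSolenoidMeasure τ) (j : ℤ) (n : ℕ) (k : ℤ) :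
    charVec hτ n (k + 3 ^ n * j) =ᵐ[τ] fun ζ => ((proj 0 ζ : Circle) : ℂ) ^ j * charVec hτ n k ζ := by
  filter_upwards [charVec_coeFn hτ n k, charVec_coeFn hτ n (k + 3 ^ n * j)] with ζ h1 h2
  have h : ((proj n ζ : Circle) : ℂ) ^ (3 ^ n * j : ℤ) = (proj 0 ζ : ℂ) ^ j := by
    rw [zpow_mul, ← proj_pow_eq_zero n ζ, Circle.coe_pow]
    norm_cast
  rw [h1, h2, normChar, normChar, zpow_add₀ (Circle.coe_ne_zero _), h]
  ring

end Measure

end CantorSolenoid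

end

theorem corollary6p5 :
    (∃! ν : Measure filledCantor,
      IsCantorMeasure ν) ∧
    (∃! τ : Measure Solenoid,
      IsSolenoidMeasure τ) ∧
    ∀ (ν : Measure filledCantor)
      (hν : IsCantorMeasure ν)
      (τ : Measure Solenoid)
      (_ : IsSolenoidMeasure τ),
      ∃ F : Lp ℂ 2 ν ≃ₗᵢ[ℂ] Lp ℂ 2 τ,
        (∀ f : Lp ℂ 2 τ,
          F (dilation hν (F.symm f)) =ᵐ[τ] fun ζ =>
            cantorFilter (proj 0 ζ) *
              f (shift ζ)) ∧
        (∀ (k : ℤ) (f : Lp ℂ 2 τ),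
          F (translation hν k (F.symm f)) =ᵐ[τ] fun ζ =>
            ((proj 0 ζ : Circle) : ℂ) ^ k * f ζ) ∧
        F (indicatorConstLp 2 measurableSet_cantorPart
            hν.cantor_ne_top (1 : ℂ)) =ᵐ[τ] fun _ => (1 : ℂ) := by
  refine ⟨?_, ?_, fun ν hν τ hτ => ?_⟩
  · obtain ⟨ν, hν⟩ := exists_isCantorMeasure
    exact ⟨ν, hν, fun ν' hν' => hν'.eq hν⟩
  · obtain ⟨τ, hτ⟩ := exists_isSolenoidMeasure
    exact ⟨τ, hτ, fun τ' hτ' => hτ'.eq hτ⟩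
  · obtain ⟨F, hF⟩ := (isCantorScaling_pieceVec hν).exists_unitary (isCantorScaling_charVec hτ)
      (pieceVec_total hν) (charVec_total hτ)
    have hFs : ∀ n k, F.symm (charVec hτ n k) = pieceVec hν n k := fun n k => by
      rw [← hF, F.symm_apply_apply]
    refine ⟨F, fun f => ?_, fun j f => ?_, ?_⟩
    · refine ae_eq_weighted_comp
        (((F.symm.trans (dilation hν)).trans F).toContinuousLinearEquiv :
          Lp ℂ 2 τ →L[ℂ] Lp ℂ 2 τ) (fun ζ => cantorFilter (proj 0 ζ))
        hτ.quasiMeasurePreserving_shift _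
        ((isCantorScaling_charVec hτ).total_succ (charVec_total hτ)) (fun i => ?_) f
      change F (dilation hν (F.symm (charVec hτ (i.1 + 1) i.2))) =ᵐ[τ] _
      rw [hFs, dilation_pieceVec, hF]
      exact charVec_shift hτ i.1 i.2
    · refine ae_eq_weighted_comp
        (((F.symm.trans (translation hν j)).trans F).toContinuousLinearEquiv :
          Lp ℂ 2 τ →L[ℂ] Lp ℂ 2 τ) (fun ζ => ((proj 0 ζ : Circle) : ℂ) ^ j)
        -- Multiplication by ζ₀ʲ is a weighted composition operator with the identity as its map.
        (Measure.QuasiMeasurePreserving.id τ) _ (charVec_total hτ) (fun i => ?_) f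
      change F (translation hν j (F.symm (charVec hτ i.1 i.2))) =ᵐ[τ] _
      rw [hFs, translation_pieceVec, hF]
      exact charVec_mul_zpow hτ j i.1 i.2
    · rw [← pieceVec_zero_zero hν, hF]
      exact charVec_zero_zero hτ
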